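/- Let $X$ be a finite-dimensional (Hausdorff, paracompact) differentiable manifold, endowed with the Lebesgue measure associated with some Riemannian metric. Let $\mathscr{L}^\infty(X)$ be the space of bounded measurable functions on $X$ (real- or complex-valued, measurable in the sense of Lebesgue), endowed with pointwise operations, and let $L^\infty(X)$ be its quotient by equality locally almost everywhere; write $[f]\in L^\infty(X)$ for the class of $f$. Let $G$ be a locally compact group with a continuous action on $X$ such that: 1. the action is $C^1$-continuous: each $g\in G$ is differentiable at each $x\in X$, and the derivative $d_xg$ depends continuously on $(g,x)\in G\times X$; 2. the action is amenable: for a left Haar measure $dg$ on $G$, there is a net $(\mu_i)_{i\in I}$ of non-negative continuous functions on $G\times X$ such that $\int_G\mu_i(g,x)\,dg=1$ for all $i\in I$ and $x\in X$, and $\lim_{i\in I}\int_G|\mu_i(sg,sx)-\mu_i(g,x)|\,dg=0$ uniformly for $(s,x)$ in compact subsets of $G\times X$. Then there is a $G$-equivariant strong linear lifting $\lambda\colon L^\infty(X)\to\mathscr{L}^\infty(X)$. That is, there is a linear map $\lambda\colon L^\infty(X)\to\mathscr{L}^\infty(X)$ which is positive (if $\varphi\ge 0$ almost everywhere then $\lambda(\varphi)\ge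 0$ everywhere), satisfies $[\lambda(\varphi)]=\varphi$ for all $\varphi\in L^\infty(X)$ and $\lambda([\mathbf 1_X])=\mathbf 1_X$, satisfies $\lambda([f])=f$ for every bounded continuous function $f$ on $X$, and satisfies $\lambda(s\varphi)=s\lambda(\varphi)$ for all $s\in G$ and $\varphi\in L^\infty(X)$, where $(sf)(x)=f(s^{-1}x)$ and $s[f]=[sf]$. -/

import Mathlib

open MeasureTheory Topology Manifold
open scoped ENNReal Manifold Bundle ComplexOrder

universe u v w

noncomputable section

section Volume

variable {d : ℕ} {X : Type v} [TopologicalSpace X] [ChartedSpace (EuclideanSpace ℝ (Fin d)) X]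
  [IsManifold (𝓡 d) 1 X]

/-- The Gram matrix `(gᵢⱼ(p))` of a Riemannian metric `γ` in the chart `e`, at a point `p` of the
target of `e`: the inner products of the coordinate vector fields `∂ᵢ = d(e⁻¹)ₚ(eᵢ)`. -/
def gramMatrix
    (γ : Bundle.ContinuousRiemannianMetric (EuclideanSpace ℝ (Fin d))
      (fun x : X ↦ TangentSpace (𝓡 d) x))
    (e : OpenPartialHomeomorph X (EuclideanSpace ℝ (Fin d))) (p : EuclideanSpace ℝ (Fin d)) :
    Matrix (Fin d) (Fin d) ℝ :=
  Matrix.of fun i j ↦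
    γ.inner (e.symm p)
      (mfderiv (𝓡 d) (𝓡 d) e.symm p (EuclideanSpace.single i (1 : ℝ)))
      (mfderiv (𝓡 d) (𝓡 d) e.symm p (EuclideanSpace.single j (1 : ℝ)))

variable [MeasurableSpace X]

/-- The Riemannian measure on the domain of the chart `e` (extended by zero to `X`):
`√(det gᵢⱼ) dx₁ ⋯ dx_d` in the coordinates given by `e`. -/
def chartVolume
    (γ : Bundle.ContinuousRiemannianMetric (EuclideanSpace ℝ (Fin d))
      (fun x : X ↦ TangentSpace (𝓡 d) x))
    (e : OpenPartialHomeomorph X (EuclideanSpace ℝ (Fin d))) : Measure X :=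
  (((volume : Measure (EuclideanSpace ℝ (Fin d))).restrict e.target).withDensity
    fun p ↦ ENNReal.ofReal (√ (gramMatrix γ e p).det)).map e.symm

/-- The Lebesgue measure of `X` associated with the Riemannian metric `γ`. The chart measures agree
on the overlaps of the charts, and the Riemannian measure is their least upper bound in the
complete lattice of measures on `X`. When `X` has uncountably many connected components, it is the
sum of the Riemannian measures of the components; then (for paracompact `X`) null sets are exactly
the locally null sets. -/
def riemannianVolume
    (γ : Bundle.ContinuousRiemannianMetric (EuclideanSpace ℝ (Fin d))
      (fun x : X ↦ TangentSpace (𝓡 d) x)) : Measure X :=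
  ⨆ e ∈ atlas (EuclideanSpace ℝ (Fin d)) X, chartVolume γ e

end Volume

section Liftings

variable {X : Type v} [MeasurableSpace X]

/-- The space `𝓛^∞(X)` of bounded (everywhere, not just essentially) functions on `X` that are
measurable for the completion of `μ`, with values in `𝕜 = ℝ` or `ℂ`. -/
def ScriptLInf (𝕜 : Type*) [RCLike 𝕜] (μ : Measure X) : Submodule 𝕜 (X → 𝕜) where
  carrier := {f | AEStronglyMeasurable f μ ∧ ∃ C : ℝ, ∀ x, ‖f x‖ ≤ C}
  zero_mem' := ⟨aestronglyMeasurable_const, 0, fun x ↦ by simp⟩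
  add_mem' := by
    rintro f h ⟨hf, C, hC⟩ ⟨hh, D, hD⟩
    exact ⟨hf.add hh, C + D, fun x ↦ (norm_add_le _ _).trans (add_le_add (hC x) (hD x))⟩
  smul_mem' := by
    rintro c f ⟨hf, C, hC⟩
    refine ⟨hf.const_smul c, ‖c‖ * C, fun x ↦ ?_⟩
    rw [Pi.smul_apply, norm_smul]
    exact mul_le_mul_of_nonneg_left (hC x) (norm_nonneg c)

variable {𝕜 : Type*} [RCLike 𝕜] {μ : Measure X}

theorem ScriptLInf.memLp (f : ScriptLInf 𝕜 μ) : MemLp (f : X → 𝕜) ∞ μ :=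
  let ⟨hf, C, hC⟩ := f.2
  memLp_top_of_bound hf C (Filter.Eventually.of_forall hC)

/-- The function class `[f]` in `L^∞(X)` of a function `f` in `𝓛^∞(X)`. -/
def ScriptLInf.toClass (f : ScriptLInf 𝕜 μ) : Lp 𝕜 ∞ μ :=
  (ScriptLInf.memLp f).toLp (f : X → 𝕜)

/-- A linear lifting: a positive linear map `L^∞(X) → 𝓛^∞(X)` that picks a representative of every
class and maps the class of the constant function `1` to the constant function `1`. -/
structure IsLinearLifting (Λ : Lp 𝕜 ∞ μ →ₗ[𝕜] ScriptLInf 𝕜 μ) : Prop where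
  /-- positivity -/
  nonneg : ∀ φ : Lp 𝕜 ∞ μ, (∀ᵐ x ∂μ, 0 ≤ φ x) → ∀ x, 0 ≤ (Λ φ : X → 𝕜) x
  /-- `Λ φ` is in the class `φ` -/
  toClass_apply : ∀ φ : Lp 𝕜 ∞ μ, ScriptLInf.toClass (Λ φ) = φ
  /-- `Λ [1] = 1` -/
  map_one : ∀ f : ScriptLInf 𝕜 μ, (f : X → 𝕜) = 1 → Λ (ScriptLInf.toClass f) = f

/-- A strong linear lifting: moreover `Λ [f] = f` for every bounded continuous function `f`. -/
structure IsStrongLinearLifting [TopologicalSpace X] (Λ : Lp 𝕜 ∞ μ →ₗ[𝕜] ScriptLInf 𝕜 μ) : Prop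
    extends IsLinearLifting Λ where
  /-- `Λ [f] = f` for `f` continuous -/
  map_continuous : ∀ f : ScriptLInf 𝕜 μ, Continuous (f : X → 𝕜) → Λ (ScriptLInf.toClass f) = f

/-- `G`-equivariance of a linear map `L^∞(X) → 𝓛^∞(X)`, where `(s f)(x) = f (s⁻¹ x)` for functions
and `s [f] = [s f]` for function classes. The condition includes that `s f` belongs to `𝓛^∞(X)`
whenever `f` does; when `Λ` is a lifting it forces `[s f]` to depend only on `[f]`. -/
def IsEquivariant (G : Type u) [Group G] [MulAction G X]
    (Λ : Lp 𝕜 ∞ μ →ₗ[𝕜] ScriptLInf 𝕜 μ) : Prop :=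
  ∀ (s : G) (f : ScriptLInf 𝕜 μ),
    ∃ hsf : (fun x ↦ (f : X → 𝕜) (s⁻¹ • x)) ∈ ScriptLInf 𝕜 μ,
      ∀ x, (Λ (ScriptLInf.toClass ⟨_, hsf⟩) : X → 𝕜) x = (Λ (ScriptLInf.toClass f) : X → 𝕜) (s⁻¹ • x)

end Liftings

section Actions

/-- (Topological) amenability of an action of a locally compact group `G` on a space `X`: there is a
net of non-negative continuous functions `m i` on `G × X` with `∫ m i (g, x) dg = 1` for all `x`
and `∫ |m i (s g, s x) - m i (g, x)| dg → 0` uniformly for `(s, x)` in compact subsets of `G × X`;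
here `dg` is a left Haar measure. -/
def IsAmenableAction (G : Type u) (X : Type v) [Group G] [TopologicalSpace G]
    [IsTopologicalGroup G] [LocallyCompactSpace G] [MeasurableSpace G] [BorelSpace G]
    [TopologicalSpace X] [MulAction G X] : Prop :=
  ∃ (ι : Type w) (_ : Preorder ι) (_ : IsDirectedOrder ι) (_ : Nonempty ι) (m : ι → G × X → ℝ),
    (∀ i, Continuous (m i)) ∧
    (∀ i p, 0 ≤ m i p) ∧
    (∀ i x, ∫ g, m i (g, x) ∂Measure.haar = 1) ∧
    ∀ K : Set (G × X), IsCompact K →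
      TendstoUniformlyOn
        (fun (i : ι) (p : G × X) ↦
          ∫ g, |m i (p.1 * g, p.1 • p.2) - m i (g, p.2)| ∂Measure.haar)
        (fun _ ↦ 0) Filter.atTop K

/-- A `C¹`-continuous action on a manifold: the action is continuous, every `g` is differentiable,
and the derivative `d_x g` depends continuously on `(g, x)`, in the sense that
`(g, x, ξ) ↦ (g x, d_x g (ξ))` is continuous on `G × TX`. -/
structure IsC1ContinuousAction (G : Type u) (d : ℕ) (X : Type v) [Group G] [TopologicalSpace G]
    [TopologicalSpace X] [ChartedSpace (EuclideanSpace ℝ (Fin d)) X] [IsManifold (𝓡 d) 1 X]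
    [MulAction G X] : Prop where
  /-- the action is continuous -/
  continuous_smul : Continuous fun p : G × X ↦ p.1 • p.2
  /-- each group element is differentiable at each point -/
  mdifferentiable : ∀ g : G, MDifferentiable (𝓡 d) (𝓡 d) fun x : X ↦ g • x
  /-- the derivative is continuous on `G × TX` -/
  continuous_tangentMap : Continuous fun p : G × TangentBundle (𝓡 d) X ↦
    tangentMap (𝓡 d) (𝓡 d) (fun x : X ↦ p.1 • x) p.2

end Actions

end

/-! Averaging `f` over small balls and letting the radius tend to zero along an ultrafilter gives a
linear lifting: by Lebesgue differentiation it returns `f` almost everywhere, and everywhere if `f`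
is continuous. The balls depend on charts, so this lifting is not equivariant. To repair this, the
local averages are conjugated by group elements and averaged over `G`: put `u f x i n = ∫ m i (g, x)
• Aₙ(f ∘ g)(g⁻¹ x) dg`, where `Aₙ` averages over balls of radius `1 / (n + 1)` in charts, and take
the limit along ultrafilters, first in `n`, then in `i`.

Two facts carry the proof. At a Lebesgue point `x` of `f`, and for each fixed `g`, the average of `f
∘ g` about `g⁻¹ x` tends to `f x`, because `g` and `g⁻¹` are locally Lipschitz in charts and so
distort small balls by bounded factors (`tendsto_chartAverage_smul`). Dominated convergence then
makes the inner limit `f x` for every `i` (`tendsto_groupAverage`). Secondly, by left invariance of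
Haar measure, translating `f` by `s` replaces the weight `m i (g, s⁻¹ x)` by `m i (s g, x)`
(`groupAverage_translate`). This changes the average by at most an `L¹` distance that is independent
of `n` and tends to zero with `i` (`norm_groupAverage_sub_le`), so the outer limit is equivariant.

Neither `X` nor `G` is assumed second countable. Null sets are therefore treated as sets that are
null in every chart (`riemannianVolume_eq_zero_iff`), and measurability in `g` rests on the fact
that an integrable weight meets only countably many members of a partition of unity
(`countable_support_mul_partitionOfUnity`). -/

noncomputable section

/-! ### Lipschitz bounds for differentiable maps read in charts. -/

section ChartTransitions

variable {d : ℕ} {X : Type v} [TopologicalSpace X] [ChartedSpace (EuclideanSpace ℝ (Fin d)) X]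
  [IsManifold (𝓡 d) 1 X]

theorem continuousAt_tangentMap_of_contMDiffOn {Y : Type*} [TopologicalSpace Y]
    [ChartedSpace (EuclideanSpace ℝ (Fin d)) Y] [IsManifold (𝓡 d) 1 Y] {f : X → Y} {s : Set X}
    (hs : IsOpen s) (hf : ContMDiffOn (𝓡 d) (𝓡 d) 1 f s) (q : TangentBundle (𝓡 d) X) (hq : q.proj ∈ s) :
    ContinuousAt (tangentMap (𝓡 d) (𝓡 d) f) q := by
  have h := hf.continuousOn_tangentMapWithin le_rfl hs.uniqueMDiffOn
  have hs' : (Bundle.TotalSpace.proj ⁻¹' s : Set (TangentBundle (𝓡 d) X)) ∈ 𝓝 q :=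
    (hs.preimage (FiberBundle.continuous_proj (EuclideanSpace ℝ (Fin d))
      (TangentSpace (𝓡 d) (M := X)))).mem_nhds hq
  refine (h.continuousAt hs').congr ?_
  filter_upwards [hs'] with q' hq'
  exact tangentMapWithin_eq_tangentMap (hs.uniqueMDiffWithinAt hq')
    ((hf.mdifferentiableOn one_ne_zero).mdifferentiableAt (hs.mem_nhds hq'))

variable {e₁ e₂ : OpenPartialHomeomorph X (EuclideanSpace ℝ (Fin d))} {h : X → X}

theorem chart_symm_contMDiffOn (h₁ : e₁ ∈ atlas (EuclideanSpace ℝ (Fin d)) X) :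
    ContMDiffOn (𝓡 d) (𝓡 d) 1 e₁.symm e₁.target :=
  contMDiffOn_symm_of_mem_maximalAtlas (IsManifold.subset_maximalAtlas h₁)

theorem chart_contMDiffOn (h₁ : e₁ ∈ atlas (EuclideanSpace ℝ (Fin d)) X) :
    ContMDiffOn (𝓡 d) (𝓡 d) 1 e₁ e₁.source :=
  contMDiffOn_of_mem_maximalAtlas (IsManifold.subset_maximalAtlas h₁)

theorem transition_hasMFDerivAt
    (h₁ : e₁ ∈ atlas (EuclideanSpace ℝ (Fin d)) X)
    (h₂ : e₂ ∈ atlas (EuclideanSpace ℝ (Fin d)) X)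
    (hh : MDifferentiable (𝓡 d) (𝓡 d) h) {p : EuclideanSpace ℝ (Fin d)}
    (hp : p ∈ e₁.target) (hp' : h (e₁.symm p) ∈ e₂.source) :
    HasMFDerivAt (𝓡 d) (𝓡 d) (e₂ ∘ h ∘ e₁.symm) p
      ((mfderiv (𝓡 d) (𝓡 d) e₂ (h (e₁.symm p))).comp
        ((mfderiv (𝓡 d) (𝓡 d) h (e₁.symm p)).comp (mfderiv (𝓡 d) (𝓡 d) e₁.symm p))) := by
  have m₁ := ((mdifferentiable_of_mem_atlas (I := 𝓡 d) h₁).mdifferentiableAt_symm hp).hasMFDerivAt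
  have m₂ := ((mdifferentiable_of_mem_atlas (I := 𝓡 d) h₂).mdifferentiableAt hp').hasMFDerivAt
  exact m₂.comp p ((hh _).hasMFDerivAt.comp p m₁)

theorem transition_differentiableAt
    (h₁ : e₁ ∈ atlas (EuclideanSpace ℝ (Fin d)) X)
    (h₂ : e₂ ∈ atlas (EuclideanSpace ℝ (Fin d)) X)
    (hh : MDifferentiable (𝓡 d) (𝓡 d) h) {p : EuclideanSpace ℝ (Fin d)}
    (hp : p ∈ e₁.target) (hp' : h (e₁.symm p) ∈ e₂.source) :
    DifferentiableAt ℝ (e₂ ∘ h ∘ e₁.symm) p :=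
  (transition_hasMFDerivAt h₁ h₂ hh hp hp').mdifferentiableAt.differentiableAt

/-- A `C¹` map of a manifold is locally Lipschitz in charts. -/
theorem transition_locallyLipschitz
    (h₁ : e₁ ∈ atlas (EuclideanSpace ℝ (Fin d)) X)
    (h₂ : e₂ ∈ atlas (EuclideanSpace ℝ (Fin d)) X)
    (hh : MDifferentiable (𝓡 d) (𝓡 d) h)
    (hc : Continuous (tangentMap (𝓡 d) (𝓡 d) h)) {p : EuclideanSpace ℝ (Fin d)}
    (hp : p ∈ e₁.target) (hp' : h (e₁.symm p) ∈ e₂.source) :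
    ∃ K : NNReal, ∃ δ > 0, LipschitzOnWith K (e₂ ∘ h ∘ e₁.symm) (Metric.ball p δ) := by
  let Ψ : EuclideanSpace ℝ (Fin d) × EuclideanSpace ℝ (Fin d) →
      TangentBundle (𝓡 d) (EuclideanSpace ℝ (Fin d)) := fun z ↦
    tangentMap (𝓡 d) (𝓡 d) e₂ (tangentMap (𝓡 d) (𝓡 d) h
      (tangentMap (𝓡 d) (𝓡 d) e₁.symm ((tangentBundleModelSpaceHomeomorph (𝓡 d)).symm z)))
  -- Continuity at the zero vector over `p` is what bounds the derivatives: vectors shorter than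
  -- some `δ₂`, at points near `p`, have images shorter than `1`.
  have hΨ : ContinuousAt Ψ (p, 0) := by
    have c₁ : ContinuousAt (fun z : EuclideanSpace ℝ (Fin d) × EuclideanSpace ℝ (Fin d) ↦
        tangentMap (𝓡 d) (𝓡 d) e₁.symm
        ((tangentBundleModelSpaceHomeomorph (𝓡 d)).symm z)) (p, 0) :=
      ContinuousAt.comp (f := fun z : EuclideanSpace ℝ (Fin d) × EuclideanSpace ℝ (Fin d) ↦
          (tangentBundleModelSpaceHomeomorph (𝓡 d)).symm z)
        (continuousAt_tangentMap_of_contMDiffOn e₁.open_target (chart_symm_contMDiffOn h₁)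
          ((tangentBundleModelSpaceHomeomorph (𝓡 d)).symm (p, 0)) hp)
        (tangentBundleModelSpaceHomeomorph (𝓡 d)).symm.continuous.continuousAt
    exact ContinuousAt.comp (g := tangentMap (𝓡 d) (𝓡 d) e₂)
      (continuousAt_tangentMap_of_contMDiffOn e₂.open_source (chart_contMDiffOn h₂) _ hp')
      (hc.continuousAt.comp c₁)
  have hΨ' : ContinuousAt (fun z ↦ (tangentBundleModelSpaceHomeomorph (𝓡 d) (Ψ z)).2) (p, 0) :=
    continuous_snd.continuousAt.comp
      ((tangentBundleModelSpaceHomeomorph (𝓡 d)).continuous.continuousAt.comp hΨ)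
  have hval : ∀ z v, (tangentBundleModelSpaceHomeomorph (𝓡 d) (Ψ (z, v))).2 =
      ((mfderiv (𝓡 d) (𝓡 d) e₂ (h (e₁.symm z))).comp
        ((mfderiv (𝓡 d) (𝓡 d) h (e₁.symm z)).comp (mfderiv (𝓡 d) (𝓡 d) e₁.symm z))) v :=
    fun z v ↦ rfl
  have hev : ∀ᶠ z in 𝓝 p, z ∈ e₁.target ∧ h (e₁.symm z) ∈ e₂.source := by
    refine (e₁.open_target.eventually_mem hp).and ?_
    exact (hh.continuous.continuousAt.comp (e₁.continuousAt_symm hp)).eventually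
      (e₂.open_source.eventually_mem hp')
  have hsmall := hΨ'.eventually (Metric.ball_mem_nhds _ one_pos)
  obtain ⟨δ₁, hδ₁, H₁⟩ := Metric.eventually_nhds_iff_ball.1 hev
  obtain ⟨δ₂, hδ₂, H₂⟩ := Metric.eventually_nhds_iff_ball.1 hsmall
  have hbound : ∀ z ∈ Metric.ball p (min δ₁ δ₂),
      ‖fderiv ℝ (e₂ ∘ h ∘ e₁.symm) z‖ ≤ 2 / δ₂ := by
    intro z hz
    have hz₁ := H₁ z (Metric.ball_subset_ball (min_le_left _ _) hz)
    let D : EuclideanSpace ℝ (Fin d) →L[ℝ] EuclideanSpace ℝ (Fin d) :=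
      (mfderiv (𝓡 d) (𝓡 d) e₂ (h (e₁.symm z))).comp
        ((mfderiv (𝓡 d) (𝓡 d) h (e₁.symm z)).comp (mfderiv (𝓡 d) (𝓡 d) e₁.symm z))
    have hd : HasFDerivAt (e₂ ∘ h ∘ e₁.symm) D z :=
      hasMFDerivAt_iff_hasFDerivAt.1 (transition_hasMFDerivAt h₁ h₂ hh hz₁.1 hz₁.2)
    rw [hd.fderiv]
    -- It suffices to test vectors with `δ₂ / 2 ≤ ‖v‖ < δ₂`. Their images have norm below `1`, hence
    -- the bound `2 / δ₂`.
    refine ContinuousLinearMap.opNorm_le_of_shell (c := (2 : ℝ)) hδ₂ (by positivity) (by norm_num)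
      fun v hv hv' ↦ ?_
    have hzv : (z, v) ∈ Metric.ball ((p, 0) : EuclideanSpace ℝ (Fin d) × EuclideanSpace ℝ (Fin d)) δ₂ := by
      rw [Metric.mem_ball, Prod.dist_eq]
      exact max_lt (lt_of_lt_of_le hz (min_le_right _ _)) (by simpa using hv')
    have h3 : dist (tangentBundleModelSpaceHomeomorph (𝓡 d) (Ψ (z, v))).2
        (tangentBundleModelSpaceHomeomorph (𝓡 d) (Ψ (p, 0))).2 < 1 := H₂ _ hzv
    have h0 : (tangentBundleModelSpaceHomeomorph (𝓡 d) (Ψ (p, 0))).2 = 0 := by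
      rw [hval]; exact map_zero _
    rw [h0, hval] at h3
    refine ((dist_zero_right (D v)).symm.trans_lt h3).le.trans ?_
    rw [Real.norm_ofNat] at hv
    rw [div_mul_eq_mul_div, le_div_iff₀ hδ₂]
    linarith
  refine ⟨⟨2 / δ₂, by positivity⟩, min δ₁ δ₂, lt_min hδ₁ hδ₂, ?_⟩
  refine (convex_ball _ _).lipschitzOnWith_of_nnnorm_fderiv_le (𝕜 := ℝ) (fun z hz ↦ ?_)
    fun z hz ↦ hbound z hz
  have hz₁ := H₁ z (Metric.ball_subset_ball (min_le_left _ _) hz)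
  exact transition_differentiableAt h₁ h₂ hh hz₁.1 hz₁.2

end ChartTransitions

/-! ### Null sets of the Riemannian measure and their invariance. -/

section RiemannianNullSets

variable {d : ℕ} {X : Type v} [TopologicalSpace X] [ChartedSpace (EuclideanSpace ℝ (Fin d)) X]
  [IsManifold (𝓡 d) 1 X]

theorem gramMatrix_continuousOn
    (γ : Bundle.ContinuousRiemannianMetric (EuclideanSpace ℝ (Fin d))
      (fun x : X ↦ TangentSpace (𝓡 d) x))
    {e : OpenPartialHomeomorph X (EuclideanSpace ℝ (Fin d))}
    (he : e ∈ atlas (EuclideanSpace ℝ (Fin d)) X) :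
    ContinuousOn (gramMatrix γ e) e.target := by
  have hfield : ∀ w : EuclideanSpace ℝ (Fin d), ContinuousOn
      (fun p : EuclideanSpace ℝ (Fin d) ↦ (⟨e.symm p, mfderiv (𝓡 d) (𝓡 d) e.symm p w⟩ :
        TangentBundle (𝓡 d) X)) e.target := by
    intro w p hp
    have h₁ := continuousAt_tangentMap_of_contMDiffOn e.open_target (chart_symm_contMDiffOn he)
      ((tangentBundleModelSpaceHomeomorph (𝓡 d)).symm (p, w)) hp
    have h₂ : ContinuousAt (fun z : EuclideanSpace ℝ (Fin d) ↦
        (tangentBundleModelSpaceHomeomorph (𝓡 d)).symm (z, w)) p :=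
      (tangentBundleModelSpaceHomeomorph (𝓡 d)).symm.continuous.continuousAt.comp
        (Continuous.prodMk_left w).continuousAt
    exact (ContinuousAt.comp (f := fun z : EuclideanSpace ℝ (Fin d) ↦
        (tangentBundleModelSpaceHomeomorph (𝓡 d)).symm (z, w)) h₁ h₂).continuousWithinAt
  refine continuousOn_pi.2 fun i ↦ continuousOn_pi.2 fun j ↦ ?_
  have hγ : ContinuousOn (fun p : EuclideanSpace ℝ (Fin d) ↦
      (⟨e.symm p, γ.inner (e.symm p)⟩ : Bundle.TotalSpace
        (EuclideanSpace ℝ (Fin d) →L[ℝ] EuclideanSpace ℝ (Fin d) →L[ℝ] ℝ)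
        (fun x : X ↦ TangentSpace (𝓡 d) x →L[ℝ] TangentSpace (𝓡 d) x →L[ℝ] ℝ))) e.target :=
    γ.continuous.comp_continuousOn e.continuousOn_symm
  have := ContinuousOn.clm_bundle_apply₂ (F₁ := EuclideanSpace ℝ (Fin d))
    (F₂ := EuclideanSpace ℝ (Fin d)) (F₃ := ℝ) (E₃ := Bundle.Trivial X ℝ)
    hγ (hfield (EuclideanSpace.single i 1)) (hfield (EuclideanSpace.single j 1))
  exact ((Bundle.Trivial.homeomorphProd X ℝ).continuous.comp_continuousOn this).snd

/-- The derivative of an inverse chart is injective, so the coordinate fields are linearly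
independent and their Gram matrix is positive definite. -/
theorem gramMatrix_det_pos
    (γ : Bundle.ContinuousRiemannianMetric (EuclideanSpace ℝ (Fin d))
      (fun x : X ↦ TangentSpace (𝓡 d) x))
    {e : OpenPartialHomeomorph X (EuclideanSpace ℝ (Fin d))}
    (he : e ∈ atlas (EuclideanSpace ℝ (Fin d)) X) {p : EuclideanSpace ℝ (Fin d)}
    (hp : p ∈ e.target) : 0 < (gramMatrix γ e p).det := by
  set L := mfderiv (𝓡 d) (𝓡 d) e.symm p with hL
  have hinj : Function.Injective L :=
    (mdifferentiable_of_mem_atlas (I := 𝓡 d) he).symm.mfderiv_injective hp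
  refine Matrix.PosDef.det_pos (Matrix.PosDef.of_dotProduct_mulVec_pos ?_ fun x hx ↦ ?_)
  · ext i j
    exact γ.symm _ _ _
  · let v : EuclideanSpace ℝ (Fin d) := ∑ i, x i • EuclideanSpace.single i (1 : ℝ)
    have hv : v ≠ 0 := by
      intro h0
      apply hx
      funext k
      have := congrArg (fun u : EuclideanSpace ℝ (Fin d) ↦ u k) h0
      simpa [v, Pi.single_apply] using this
    have hLv : L v ≠ 0 := fun h0 ↦ hv (hinj (h0.trans (map_zero L).symm))
    have hpos := γ.pos (e.symm p) (L v) hLv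
    -- The metric pulled back to the model space; expanding `B v v` in the standard basis gives the
    -- quadratic form of the Gram matrix.
    let B : EuclideanSpace ℝ (Fin d) →ₗ[ℝ] EuclideanSpace ℝ (Fin d) →ₗ[ℝ] ℝ :=
      LinearMap.mk₂ ℝ (fun a b ↦ γ.inner (e.symm p) (L a) (L b))
        (fun a a' b ↦ (congrArg (fun u ↦ γ.inner (e.symm p) u (L b)) (map_add L a a')).trans
          (by rw [map_add]; rfl))
        (fun c a b ↦ (congrArg (fun u ↦ γ.inner (e.symm p) u (L b)) (map_smul L c a)).trans
          (by rw [map_smul]; rfl))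
        (fun a b b' ↦ (congrArg (γ.inner (e.symm p) (L a)) (map_add L b b')).trans (map_add _ _ _))
        (fun c a b ↦ (congrArg (γ.inner (e.symm p) (L a)) (map_smul L c b)).trans (map_smul _ _ _))
    have hB : B v v = star x ⬝ᵥ (gramMatrix γ e p).mulVec x := by
      have hG : ∀ i j, gramMatrix γ e p i j =
        B (EuclideanSpace.single i 1) (EuclideanSpace.single j 1) := fun i j ↦ rfl
      simp only [v, map_sum, map_smul, LinearMap.sum_apply, LinearMap.smul_apply, smul_eq_mul,
        dotProduct, Matrix.mulVec, hG, star_trivial, Finset.mul_sum]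
      rw [Finset.sum_comm]
      exact Finset.sum_congr rfl fun i _ ↦ Finset.sum_congr rfl fun j _ ↦ by ring
    rw [← hB]
    exact hpos

/-- Null sets are mapped to null sets by differentiable maps, in charts. -/
theorem volume_chart_preimage_eq_zero {e₁ e₂ : OpenPartialHomeomorph X (EuclideanSpace ℝ (Fin d))}
    (h₁ : e₁ ∈ atlas (EuclideanSpace ℝ (Fin d)) X) (h₂ : e₂ ∈ atlas (EuclideanSpace ℝ (Fin d)) X)
    {h k : X → X} (hk : MDifferentiable (𝓡 d) (𝓡 d) k)
    (hkh : ∀ x, k (h x) = x) {A : Set X}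
    (hA : volume (e₂.target ∩ e₂.symm ⁻¹' A) = 0) :
    volume (e₁.target ∩ e₁.symm ⁻¹' (h ⁻¹' (A ∩ e₂.source))) = 0 := by
  -- Since `k` is a left inverse of `h`, the preimage under `h` lies in an image under `k`, and
  -- differentiable maps of Euclidean space preserve null sets.
  have hd : DifferentiableOn ℝ (e₁ ∘ k ∘ e₂.symm)
      (e₂.target ∩ e₂.symm ⁻¹' (A ∩ (k ⁻¹' e₁.source))) := fun p hp ↦
    (transition_differentiableAt h₂ h₁ hk hp.1 hp.2.2).differentiableWithinAt
  refine measure_mono_null ?_ (addHaar_image_eq_zero_of_differentiableOn_of_addHaar_eq_zero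
    volume hd (measure_mono_null (Set.inter_subset_inter_right _
      (Set.preimage_mono Set.inter_subset_left)) hA))
  rintro p ⟨hp, hpA, hps⟩
  refine ⟨e₂ (h (e₁.symm p)), ⟨e₂.map_source hps, ?_, ?_⟩, ?_⟩
  · simpa [e₂.left_inv hps] using hpA
  · simpa [e₂.left_inv hps, hkh] using e₁.map_target hp
  · simp [e₂.left_inv hps, hkh, e₁.right_inv hp]

/-- A set is locally null if it is Lebesgue null in all preferred charts. -/
def IsLocNull (d : ℕ) {X : Type v} [TopologicalSpace X]
    [ChartedSpace (EuclideanSpace ℝ (Fin d)) X] (A : Set X) : Prop :=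
  ∀ c : X, volume ((chartAt (EuclideanSpace ℝ (Fin d)) c).target ∩
    (chartAt (EuclideanSpace ℝ (Fin d)) c).symm ⁻¹' A) = 0

theorem IsLocNull.mono {Y : Type*} [TopologicalSpace Y]
    [ChartedSpace (EuclideanSpace ℝ (Fin d)) Y] {A B : Set Y} (hB : IsLocNull d B) (h : A ⊆ B) :
    IsLocNull d A :=
  fun c ↦ measure_mono_null (Set.inter_subset_inter_right _ (Set.preimage_mono h)) (hB c)

/-- Inside one chart the space is second countable, so local nullity suffices there. Near each point
the given chart is exchanged for `e` by the preceding lemma, applied to the identity. -/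
theorem isLocNull_of_locally {A : Set X}
    (hA : ∀ x ∈ A, ∃ U ∈ 𝓝 x, ∃ c : X,
      U ⊆ (chartAt (EuclideanSpace ℝ (Fin d)) c).source ∧
      volume ((chartAt (EuclideanSpace ℝ (Fin d)) c).target ∩
        (chartAt (EuclideanSpace ℝ (Fin d)) c).symm ⁻¹' (A ∩ U)) = 0)
    {e : OpenPartialHomeomorph X (EuclideanSpace ℝ (Fin d))}
    (he : e ∈ atlas (EuclideanSpace ℝ (Fin d)) X) : volume (e.target ∩ e.symm ⁻¹' A) = 0 := by
  refine measure_null_of_locally_null _ fun p hp ↦ ?_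
  obtain ⟨U, hU, c, hUc, h0⟩ := hA _ hp.2
  refine ⟨e.target ∩ e.symm ⁻¹' (A ∩ U), ?_, ?_⟩
  · have : e.symm ⁻¹' U ∈ 𝓝 p := (e.continuousAt_symm hp.1) hU
    filter_upwards [self_mem_nhdsWithin, mem_nhdsWithin_of_mem_nhds this] with q hq hqU
    exact ⟨hq.1, hq.2, hqU⟩
  · refine measure_mono_null ?_ (volume_chart_preimage_eq_zero he (chart_mem_atlas _ c)
      (h := id) (k := id) mdifferentiable_id (fun _ ↦ rfl) h0)
    exact fun q hq ↦ ⟨hq.1, hq.2, hUc hq.2.2⟩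

theorem IsLocNull.volume_eq_zero {A : Set X} (hA : IsLocNull d A)
    {e : OpenPartialHomeomorph X (EuclideanSpace ℝ (Fin d))}
    (he : e ∈ atlas (EuclideanSpace ℝ (Fin d)) X) : volume (e.target ∩ e.symm ⁻¹' A) = 0 :=
  isLocNull_of_locally (fun x _ ↦ ⟨_, chart_source_mem_nhds (EuclideanSpace ℝ (Fin d)) x, x,
    subset_rfl, measure_mono_null (Set.inter_subset_inter_right _
      (Set.preimage_mono Set.inter_subset_left)) (hA x)⟩) he

theorem IsLocNull.preimage {h k : X → X} (hk : MDifferentiable (𝓡 d) (𝓡 d) k)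
    (hh : Continuous h) (hkh : ∀ x, k (h x) = x) {A : Set X} (hA : IsLocNull d A) :
    IsLocNull d (h ⁻¹' A) := by
  intro c
  refine isLocNull_of_locally (fun x hx ↦ ?_) (chart_mem_atlas _ c)
  refine ⟨(chartAt (EuclideanSpace ℝ (Fin d)) x).source ∩
    h ⁻¹' (chartAt (EuclideanSpace ℝ (Fin d)) (h x)).source, Filter.inter_mem
      (chart_source_mem_nhds _ x) (hh.continuousAt (chart_source_mem_nhds _ (h x))), x,
      Set.inter_subset_left, ?_⟩
  refine measure_mono_null ?_ (volume_chart_preimage_eq_zero (chart_mem_atlas _ x)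
    (chart_mem_atlas _ (h x)) hk hkh (hA (h x)))
  exact fun p hp ↦ ⟨hp.1, hp.2.1, hp.2.2.2⟩

variable [MeasurableSpace X] [BorelSpace X]

theorem chartVolume_apply_eq_zero_iff
    (γ : Bundle.ContinuousRiemannianMetric (EuclideanSpace ℝ (Fin d))
      (fun x : X ↦ TangentSpace (𝓡 d) x))
    {e : OpenPartialHomeomorph X (EuclideanSpace ℝ (Fin d))}
    (he : e ∈ atlas (EuclideanSpace ℝ (Fin d)) X) {A : Set X} (hA : MeasurableSet A) :
    chartVolume γ e A = 0 ↔ volume (e.target ∩ e.symm ⁻¹' A) = 0 := by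
  have hdens : AEMeasurable (fun p ↦ ENNReal.ofReal (√ (gramMatrix γ e p).det))
      (volume.restrict e.target) := by
    have : ContinuousOn (fun p ↦ √ (gramMatrix γ e p).det) e.target :=
      Real.continuous_sqrt.comp_continuousOn
        ((Continuous.matrix_det continuous_id).comp_continuousOn (gramMatrix_continuousOn γ he))
    exact (this.aemeasurable e.open_target.measurableSet).ennreal_ofReal
  have hpos : ∀ᵐ p ∂(volume.restrict e.target),
      ENNReal.ofReal (√ (gramMatrix γ e p).det) ≠ 0 := by
    filter_upwards [ae_restrict_mem e.open_target.measurableSet] with p hp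
    simpa using gramMatrix_det_pos γ he hp
  have hac₁ := withDensity_absolutelyContinuous' hdens hpos
  have hac₂ := withDensity_absolutelyContinuous (volume.restrict e.target)
    (fun p ↦ ENNReal.ofReal (√ (gramMatrix γ e p).det))
  have hsymm : AEMeasurable e.symm (volume.restrict e.target) :=
    e.continuousOn_symm.aemeasurable e.open_target.measurableSet
  rw [chartVolume, Measure.map_apply_of_aemeasurable (hsymm.mono_ac hac₂) hA,
    Set.inter_comm, ← Measure.restrict_apply₀' e.open_target.measurableSet.nullMeasurableSet]
  exact ⟨fun h ↦ hac₁ h, fun h ↦ hac₂ h⟩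

/-- The measurable locally null sets are null for the Riemannian measure. -/
theorem IsLocNull.riemannianVolume_eq_zero_of_measurableSet
    (γ : Bundle.ContinuousRiemannianMetric (EuclideanSpace ℝ (Fin d))
      (fun x : X ↦ TangentSpace (𝓡 d) x)) {A : Set X} (hA : IsLocNull d A)
    (hm : MeasurableSet A) : riemannianVolume γ A = 0 := by
  -- On measurable sets this measure takes only the values `0` and `∞`, and vanishes exactly on the
  -- locally null ones. It therefore dominates every chart measure, hence their supremum.
  let ν : Measure X := (∞ : ℝ≥0∞) • Measure.sum fun c : X ↦
    (volume.restrict (chartAt (EuclideanSpace ℝ (Fin d)) c).target).map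
      (chartAt (EuclideanSpace ℝ (Fin d)) c).symm
  have hmap : ∀ (c : X) {B : Set X}, MeasurableSet B →
      (volume.restrict (chartAt (EuclideanSpace ℝ (Fin d)) c).target).map
        (chartAt (EuclideanSpace ℝ (Fin d)) c).symm B =
      volume ((chartAt (EuclideanSpace ℝ (Fin d)) c).target ∩
        (chartAt (EuclideanSpace ℝ (Fin d)) c).symm ⁻¹' B) := by
    intro c B hB
    rw [Measure.map_apply_of_aemeasurable
      ((chartAt (EuclideanSpace ℝ (Fin d)) c).continuousOn_symm.aemeasurable
        (chartAt (EuclideanSpace ℝ (Fin d)) c).open_target.measurableSet) hB, Set.inter_comm,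
      Measure.restrict_apply₀'
        (chartAt (EuclideanSpace ℝ (Fin d)) c).open_target.measurableSet.nullMeasurableSet]
  have hν : ∀ {B : Set X}, MeasurableSet B → (ν B = 0 ↔ IsLocNull d B) := by
    intro B hB
    simp only [ν, Measure.smul_apply, Measure.sum_apply _ hB, smul_eq_mul, mul_eq_zero,
      ENNReal.top_ne_zero, false_or, ENNReal.tsum_eq_zero, hmap _ hB]
    rfl
  have hle : riemannianVolume γ ≤ ν := by
    refine iSup₂_le fun e he ↦ Measure.le_iff.2 fun B hB ↦ ?_
    by_cases h0 : ν B = 0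
    · rw [(chartVolume_apply_eq_zero_iff γ he hB).2 (((hν hB).1 h0).volume_eq_zero he)]
      exact zero_le
    · have : ν B = ∞ := by
        simp only [ν, Measure.smul_apply, smul_eq_mul] at h0 ⊢
        exact ENNReal.top_mul (right_ne_zero_of_mul h0)
      rw [this]
      exact le_top
  exact le_antisymm ((hle A).trans ((hν hm).2 hA).le) zero_le

theorem isLocNull_of_riemannianVolume_eq_zero
    (γ : Bundle.ContinuousRiemannianMetric (EuclideanSpace ℝ (Fin d))
      (fun x : X ↦ TangentSpace (𝓡 d) x)) {A : Set X} (hA : riemannianVolume γ A = 0) :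
    IsLocNull d A := by
  intro c
  have hle : chartVolume γ (chartAt (EuclideanSpace ℝ (Fin d)) c) ≤ riemannianVolume γ :=
    le_iSup₂ (f := fun e (_ : e ∈ atlas (EuclideanSpace ℝ (Fin d)) X) ↦ chartVolume γ e)
      _ (chart_mem_atlas _ c)
  have h0 : chartVolume γ (chartAt (EuclideanSpace ℝ (Fin d)) c)
      (toMeasurable (riemannianVolume γ) A) = 0 :=
    le_antisymm ((hle _).trans ((measure_toMeasurable A).trans hA).le) zero_le
  refine measure_mono_null ?_ ((chartVolume_apply_eq_zero_iff γ (chart_mem_atlas _ c)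
    (measurableSet_toMeasurable _ _)).1 h0)
  exact Set.inter_subset_inter_right _ (Set.preimage_mono (subset_toMeasurable _ _))

end RiemannianNullSets

/-! ### Locally null sets are null, without second countability. -/

section LocallyNullSets

theorem exists_antitone_isOpen_superset_of_null {E : Type*} [TopologicalSpace E]
    [MeasurableSpace E] {μ : Measure E} [μ.OuterRegular] {A : Set E} (hA : μ A = 0) :
    ∃ U : ℕ → Set E, Antitone U ∧ (∀ k, IsOpen (U k)) ∧ (∀ k, A ⊆ U k) ∧ μ (⋂ k, U k) = 0 := by
  have h : ∀ k : ℕ, ∃ U ⊇ A, IsOpen U ∧ μ U < ((k : ℝ≥0∞) + 1)⁻¹ := fun k ↦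
    A.exists_isOpen_lt_of_lt _ (by rw [hA]; simp)
  choose U hAU hU hμ using h
  refine ⟨fun k ↦ ⋂ l ∈ Finset.range (k + 1), U l, fun a b hab ↦ ?_, fun k ↦
    isOpen_biInter_finset fun l _ ↦ hU l, fun k ↦ Set.subset_iInter₂ fun l _ ↦ hAU l, ?_⟩
  · exact Set.biInter_subset_biInter_left (Finset.coe_subset.2 (Finset.range_mono (by omega)))
  · refine le_antisymm (ENNReal.le_of_forall_pos_le_add fun ε hε _ ↦ ?_) zero_le
    obtain ⟨k, hk⟩ := ENNReal.exists_inv_nat_lt (ENNReal.coe_ne_zero.2 hε.ne')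
    rw [zero_add]
    calc μ (⋂ k, ⋂ l ∈ Finset.range (k + 1), U l) ≤ μ (U k) :=
          measure_mono ((Set.iInter_subset _ k).trans
            (Set.biInter_subset_of_mem (by simp)))
      _ ≤ ((k : ℝ≥0∞) + 1)⁻¹ := (hμ k).le
      _ ≤ (k : ℝ≥0∞)⁻¹ := ENNReal.inv_le_inv.2 le_self_add
      _ ≤ ε := hk.le

variable {d : ℕ} {X : Type v} [TopologicalSpace X] [ChartedSpace (EuclideanSpace ℝ (Fin d)) X]
  [T2Space X] [ParacompactSpace X]

variable (d X) in
theorem exists_chart_partitionOfUnity : ∃ ρ : PartitionOfUnity X X, ∀ c x, ρ c x ≠ 0 →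
    x ∈ (chartAt (EuclideanSpace ℝ (Fin d)) c).source := by
  obtain ⟨ρ, hρ⟩ := PartitionOfUnity.exists_isSubordinate (X := X) isClosed_univ
    (fun c : X ↦ (chartAt (EuclideanSpace ℝ (Fin d)) c).source)
    (fun c ↦ (chartAt (EuclideanSpace ℝ (Fin d)) c).open_source)
    (fun x _ ↦ Set.mem_iUnion.2 ⟨x, mem_chart_source _ x⟩)
  exact ⟨ρ, fun c x hx ↦ hρ c (subset_tsupport _ hx)⟩

variable [IsManifold (𝓡 d) 1 X]

/-- A union of null sets over all charts may be uncountable and need not be measurable. Instead, a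
`Gδ` set is built: shrinking open neighbourhoods in each chart, cut off by the support of `ρ c`, are
united over `c` before being intersected over `k`. -/
theorem IsLocNull.exists_measurable_superset [MeasurableSpace X] [BorelSpace X]
    {A : Set X} (hA : IsLocNull d A) :
    ∃ B ⊇ A, MeasurableSet B ∧ IsLocNull d B := by
  obtain ⟨ρ, hρ⟩ := exists_chart_partitionOfUnity d X
  choose U hanti hopen hsub hnull using fun c ↦ exists_antitone_isOpen_superset_of_null (hA c)
  let N : X → ℕ → Set X := fun c k ↦ Function.support (ρ c) ∩
    ((chartAt (EuclideanSpace ℝ (Fin d)) c).source ∩ chartAt (EuclideanSpace ℝ (Fin d)) c ⁻¹' U c k)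
  have hN : ∀ c k, IsOpen (N c k) := fun c k ↦ (ρ c).continuous.isOpen_support.inter
    ((chartAt (EuclideanSpace ℝ (Fin d)) c).isOpen_inter_preimage (hopen c k))
  have hNnull : ∀ c, IsLocNull d (⋂ k, N c k) := by
    intro c c'
    refine isLocNull_of_locally (fun x hx ↦ ⟨_,
      (chartAt (EuclideanSpace ℝ (Fin d)) c).open_source.mem_nhds (Set.mem_iInter.1 hx 0).2.1,
      c, subset_rfl, measure_mono_null ?_ (hnull c)⟩) (chart_mem_atlas _ c')
    intro p hp
    refine Set.mem_iInter.2 fun k ↦ ?_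
    have := (Set.mem_iInter.1 hp.2.1 k).2.2
    rwa [Set.mem_preimage, OpenPartialHomeomorph.right_inv _ hp.1] at this
  have hfin : ∀ x, {c | x ∈ Function.support (ρ c)}.Finite := fun x ↦
    ρ.locallyFinite.point_finite x
  -- Each point lies in finitely many supports and `N c k` decreases in `k`, so intersection and
  -- union may be exchanged.
  have hB : ⋂ k, ⋃ c, N c k ⊆ ⋃ c, ⋂ k, N c k := by
    intro x hx
    by_contra hcon
    simp only [Set.mem_iUnion, Set.mem_iInter, not_exists, not_forall] at hcon
    choose k hk using hcon
    obtain ⟨K, hK⟩ := ((hfin x).image k).bddAbove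
    obtain ⟨c, hc⟩ := Set.mem_iUnion.1 (Set.mem_iInter.1 hx K)
    exact hk c ⟨hc.1, hc.2.1, hanti c (hK (Set.mem_image_of_mem k hc.1)) hc.2.2⟩
  refine ⟨⋂ k, ⋃ c, N c k, fun x hx ↦ Set.mem_iInter.2 fun k ↦ ?_,
    MeasurableSet.iInter fun k ↦ (isOpen_iUnion fun c ↦ hN c k).measurableSet, fun c' ↦ ?_⟩
  · obtain ⟨c, hc⟩ := ρ.exists_pos (Set.mem_univ x)
    have hxc := hρ c x hc.ne'
    refine Set.mem_iUnion.2 ⟨c, hc.ne', hxc, hsub c k ?_⟩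
    refine ⟨OpenPartialHomeomorph.map_source _ hxc, ?_⟩
    rwa [Set.mem_preimage, OpenPartialHomeomorph.left_inv _ hxc]
  · refine isLocNull_of_locally (fun x _ ↦ ?_) (chart_mem_atlas _ c')
    obtain ⟨W, hW, hWfin⟩ := ρ.locallyFinite x
    refine ⟨_, Filter.inter_mem hW (chart_source_mem_nhds (EuclideanSpace ℝ (Fin d)) x), x,
      Set.inter_subset_right, ?_⟩
    refine measure_mono_null (t := ⋃ c ∈ {c | (Function.support (ρ c) ∩ W).Nonempty},
      (chartAt (EuclideanSpace ℝ (Fin d)) x).target ∩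
        (chartAt (EuclideanSpace ℝ (Fin d)) x).symm ⁻¹' (⋂ k, N c k)) ?_
      ((measure_biUnion_null_iff hWfin.countable).2 fun c _ ↦ hNnull c x)
    intro p hp
    obtain ⟨c, hc⟩ := Set.mem_iUnion.1 (hB hp.2.1)
    exact Set.mem_iUnion₂.2 ⟨c, ⟨_, (Set.mem_iInter.1 hc 0).1, hp.2.2.1⟩, hp.1, hc⟩

theorem riemannianVolume_eq_zero_iff [MeasurableSpace X] [BorelSpace X]
    (γ : Bundle.ContinuousRiemannianMetric (EuclideanSpace ℝ (Fin d))
      (fun x : X ↦ TangentSpace (𝓡 d) x)) {A : Set X} :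
    riemannianVolume γ A = 0 ↔ IsLocNull d A := by
  refine ⟨isLocNull_of_riemannianVolume_eq_zero γ, fun hA ↦ ?_⟩
  obtain ⟨B, hAB, hm, hB⟩ := hA.exists_measurable_superset
  exact measure_mono_null hAB (hB.riemannianVolume_eq_zero_of_measurableSet γ hm)

end LocallyNullSets

/-! ### Lebesgue points and their stability under bi-Lipschitz changes of variable. -/

section LebesguePoints

/-- The set of points at which the `L¹`-oscillation of `f` over small balls tends to zero. -/
def IsLebesguePoint {E F : Type*} [PseudoMetricSpace E] [MeasureSpace E] [NormedAddCommGroup F]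
    (f : E → F) (q : E) : Prop :=
  Filter.Tendsto (fun r : ℝ ↦ (∫⁻ y in Metric.closedBall q r, ‖f y - f q‖ₑ) /
    volume (Metric.closedBall q r)) (𝓝[>] 0) (𝓝 0)

variable {d : ℕ}

theorem ae_isLebesguePoint {F : Type*} [NormedAddCommGroup F]
    {f : EuclideanSpace ℝ (Fin d) → F} (hf : LocallyIntegrable f) :
    ∀ᵐ q, IsLebesguePoint f q := by
  filter_upwards [(Besicovitch.vitaliFamily
    (volume : Measure (EuclideanSpace ℝ (Fin d)))).ae_tendsto_lintegral_enorm_sub_div hf] with q hq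
  exact hq.comp (Besicovitch.tendsto_filterAt volume q)

/-- Lebesgue measure is a multiple of the `d`-dimensional Hausdorff measure, for which the bound is
standard. -/
theorem volume_image_le_of_lipschitzOnWith {K : NNReal}
    {τ : EuclideanSpace ℝ (Fin d) → EuclideanSpace ℝ (Fin d)}
    {s : Set (EuclideanSpace ℝ (Fin d))} (hτ : LipschitzOnWith K τ s) :
    volume (τ '' s) ≤ (K : ℝ≥0∞) ^ d * volume s := by
  have h := hτ.hausdorffMeasure_image_le (d := d) (Nat.cast_nonneg d)
  have : (μH[(d : ℝ)] : Measure (EuclideanSpace ℝ (Fin d))).IsAddHaarMeasure := by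
    have := isAddHaarMeasure_hausdorffMeasure (E := EuclideanSpace ℝ (Fin d))
    rwa [finrank_euclideanSpace_fin] at this
  rw [Measure.isAddLeftInvariant_eq_smul (volume : Measure (EuclideanSpace ℝ (Fin d)))
    μH[(d : ℝ)]]
  simp only [Measure.smul_apply, ENNReal.smul_def, smul_eq_mul]
  rw [mul_left_comm]
  gcongr
  simpa using h

/-- A one-sided change of variables without Jacobians: the points of the ball that `θ` sends into
`A` lie in the `τ`-image of a part of `A`, and `τ` multiplies volume by at most `L ^ d`. -/
theorem lintegral_comp_le_of_lipschitz_inverse {K L : NNReal} {δ : ℝ}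
    {θ τ : EuclideanSpace ℝ (Fin d) → EuclideanSpace ℝ (Fin d)} {p : EuclideanSpace ℝ (Fin d)}
    (hθ : LipschitzOnWith K θ (Metric.ball p δ))
    (hτ : LipschitzOnWith L τ (Metric.closedBall (θ p) (K * δ)))
    (hinv : ∀ y ∈ Metric.ball p δ, τ (θ y) = y)
    {h : EuclideanSpace ℝ (Fin d) → ℝ≥0∞} (hh : Measurable h) :
    ∫⁻ y in Metric.ball p δ, h (θ y) ≤
      (L : ℝ≥0∞) ^ d * ∫⁻ z in Metric.closedBall (θ p) (K * δ), h z := by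
  have hm : AEMeasurable θ (volume.restrict (Metric.ball p δ)) :=
    hθ.continuousOn.aemeasurable measurableSet_ball
  have hle : (volume.restrict (Metric.ball p δ)).map θ ≤
      (L : ℝ≥0∞) ^ d • volume.restrict (Metric.closedBall (θ p) (K * δ)) := by
    refine Measure.le_iff.2 fun A hA ↦ ?_
    rw [Measure.map_apply_of_aemeasurable hm hA, Measure.smul_apply, Measure.restrict_apply hA,
      smul_eq_mul, Measure.restrict_apply₀' measurableSet_ball.nullMeasurableSet]
    refine le_trans (measure_mono ?_)
      (volume_image_le_of_lipschitzOnWith (hτ.mono Set.inter_subset_right))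
    rintro y ⟨hyA, hy⟩
    refine ⟨θ y, ⟨hyA, ?_⟩, hinv y hy⟩
    have h0 : 0 < δ := dist_nonneg.trans_lt hy
    exact (hθ.dist_le_mul y hy p (Metric.mem_ball_self h0)).trans
      (mul_le_mul_of_nonneg_left (le_of_lt hy) K.2)
  rw [← lintegral_map' hh.aemeasurable hm, ← smul_eq_mul, ← lintegral_smul_measure]
  exact lintegral_mono' hle le_rfl

theorem tendsto_average_comp_of_lipschitz_inverse {K L : NNReal} {δ : ℝ} (hδ : 0 < δ)
    {θ τ : EuclideanSpace ℝ (Fin d) → EuclideanSpace ℝ (Fin d)} {p : EuclideanSpace ℝ (Fin d)}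
    (hθ : LipschitzOnWith K θ (Metric.ball p δ))
    (hτ : LipschitzOnWith L τ (Metric.ball (θ p) δ))
    (hinv : ∀ y ∈ Metric.ball p δ, τ (θ y) = y)
    {h : EuclideanSpace ℝ (Fin d) → ℝ≥0∞} (hh : Measurable h)
    (hlim : Filter.Tendsto (fun r : ℝ ↦ (∫⁻ y in Metric.closedBall (θ p) r, h y) /
      volume (Metric.closedBall (θ p) r)) (𝓝[>] 0) (𝓝 0)) :
    Filter.Tendsto (fun r : ℝ ↦ (∫⁻ y in Metric.ball p r, h (θ y)) /
      volume (Metric.ball p r)) (𝓝[>] 0) (𝓝 0) := by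
  have hθ' : LipschitzOnWith (K + 1) θ (Metric.ball p δ) := hθ.weaken le_self_add
  -- Enlarging `K` makes the constant positive, so that `M * r` tends to zero through positive radii
  -- and `M ^ d` can be cancelled.
  set M : NNReal := K + 1 with hM
  have hMpos : (0 : ℝ) < M := by positivity
  have hscale : Filter.Tendsto (fun r : ℝ ↦ M * r) (𝓝[>] 0) (𝓝[>] 0) := by
    refine tendsto_nhdsWithin_iff.2 ⟨?_, ?_⟩
    · have : Filter.Tendsto (fun r : ℝ ↦ M * r) (𝓝 0) (𝓝 (M * 0)) :=
        (continuous_const.mul continuous_id).tendsto 0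
      rw [mul_zero] at this
      exact this.mono_left nhdsWithin_le_nhds
    · filter_upwards [self_mem_nhdsWithin] with r hr
      exact mul_pos hMpos hr
  have hlim' := ENNReal.Tendsto.const_mul (a := (L : ℝ≥0∞) ^ d * (M : ℝ≥0∞) ^ d)
    (hlim.comp hscale) (Or.inr (by finiteness))
  rw [mul_zero] at hlim'
  refine tendsto_of_tendsto_of_tendsto_of_le_of_le' tendsto_const_nhds hlim'
    (Filter.Eventually.of_forall fun _ ↦ zero_le) ?_
  have hsmall : ∀ᶠ r in 𝓝[>] (0 : ℝ), M * r < δ :=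
    (hscale.mono_right nhdsWithin_le_nhds).eventually (gt_mem_nhds hδ)
  have hsmall' : ∀ᶠ r in 𝓝[>] (0 : ℝ), r < δ := nhdsWithin_le_nhds (gt_mem_nhds hδ)
  filter_upwards [hsmall, hsmall', self_mem_nhdsWithin] with r hr hr' hr0
  have hr0' : 0 < r := hr0
  have hint := lintegral_comp_le_of_lipschitz_inverse
    (hθ'.mono (Metric.ball_subset_ball hr'.le))
    (hτ.mono (Metric.closedBall_subset_ball hr))
    (fun y hy ↦ hinv y (Metric.ball_subset_ball hr'.le hy)) hh
  have hvol : volume (Metric.closedBall (θ p) (M * r)) =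
      (M : ℝ≥0∞) ^ d * volume (Metric.ball p r) := by
    rw [Measure.addHaar_closedBall _ _ (by positivity), Measure.addHaar_ball_of_pos _ _ hr0',
      finrank_euclideanSpace_fin, mul_pow, ENNReal.ofReal_mul (by positivity), mul_assoc,
      ← NNReal.coe_pow, ENNReal.ofReal_coe_nnreal, ENNReal.coe_pow]
  have hM0 : (M : ℝ≥0∞) ^ d ≠ 0 := pow_ne_zero _ (by positivity)
  have hMt : (M : ℝ≥0∞) ^ d ≠ ∞ := by finiteness
  simp only [Function.comp_apply]
  rw [hvol]
  calc (∫⁻ y in Metric.ball p r, h (θ y)) / volume (Metric.ball p r)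
      ≤ ((L : ℝ≥0∞) ^ d * ∫⁻ z in Metric.closedBall (θ p) (M * r), h z) /
        volume (Metric.ball p r) := by gcongr
    _ = (L : ℝ≥0∞) ^ d * ((∫⁻ z in Metric.closedBall (θ p) (M * r), h z) /
        volume (Metric.ball p r)) := by rw [mul_div_assoc]
    _ = (L : ℝ≥0∞) ^ d * (((M : ℝ≥0∞) ^ d * ∫⁻ z in Metric.closedBall (θ p) (M * r), h z) /
        ((M : ℝ≥0∞) ^ d * volume (Metric.ball p r))) := by
          rw [ENNReal.mul_div_mul_left _ _ hM0 hMt]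
    _ = _ := by rw [mul_div_assoc, mul_assoc]

end LebesguePoints

/-! ### Averages over small balls in measurably chosen charts. -/

section LocalAverages

theorem measurable_indicator_comp_of_continuousOn {α β γ : Type*} [TopologicalSpace α]
    [MeasurableSpace α] [OpensMeasurableSpace α] [TopologicalSpace β] [MeasurableSpace β]
    [BorelSpace β] [MeasurableSpace γ] [Zero γ] {φ : β → γ} (hφ : Measurable φ) {h : α → β}
    {s : Set α} (hs : MeasurableSet s) (hh : ContinuousOn h s) :
    Measurable (s.indicator (φ ∘ h)) := by
  classical
  rcases s.eq_empty_or_nonempty with rfl | ⟨a, -⟩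
  · simp
  · have hm : Measurable (s.piecewise h fun _ ↦ h a) := hh.measurable_piecewise continuousOn_const hs
    have : s.indicator (φ ∘ h) = s.indicator (φ ∘ s.piecewise h fun _ ↦ h a) :=
      Set.indicator_congr fun x hx ↦ by simp [hx]
    rw [this]
    exact (hφ.comp hm).indicator hs

/-- Well-order the index set and let `j y` be the least `c` with `ρ c y ≠ 0`. Each fibre is then a
difference of two open sets, however many indices precede `c`. -/
theorem exists_measurable_selection {X : Type v} [TopologicalSpace X] [MeasurableSpace X]
    [OpensMeasurableSpace X] (ρ : PartitionOfUnity X X) :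
    ∃ j : X → X, (∀ y, ρ (j y) y ≠ 0) ∧ ∀ c, MeasurableSet {y | j y = c} := by
  classical
  let _ := linearOrderOfSTO (WellOrderingRel (α := X))
  have hwf : WellFounded ((· < ·) : X → X → Prop) := WellOrderingRel.isWellOrder.wf
  have hne : ∀ y : X, {c | ρ c y ≠ 0}.Nonempty := fun y ↦
    (ρ.exists_pos (Set.mem_univ y)).imp fun c hc ↦ hc.ne'
  refine ⟨fun y ↦ hwf.min {c | ρ c y ≠ 0} (hne y), fun y ↦ hwf.min_mem _ (hne y), fun c ↦ ?_⟩
  have : {y | hwf.min {c | ρ c y ≠ 0} (hne y) = c} =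
      Function.support (ρ c) \ ⋃ b, ⋃ (_ : b < c), Function.support (ρ b) := by
    ext y
    simp only [Set.mem_ofPred_eq, Set.mem_sdiff, Set.mem_iUnion, Function.mem_support, not_exists]
    constructor
    · rintro rfl
      exact ⟨hwf.min_mem _ (hne y), fun b hb h ↦ hwf.not_lt_min _ h hb⟩
    · rintro ⟨h₁, h₂⟩
      rcases lt_trichotomy (hwf.min {c | ρ c y ≠ 0} (hne y)) c with h | h | h
      · exact absurd (hwf.min_mem _ (hne y)) (h₂ _ h)
      · exact h
      · exact absurd h (hwf.not_lt_min _ h₁)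
  rw [this]
  exact (ρ c).continuous.isOpen_support.measurableSet.diff
    (isOpen_biUnion fun b _ ↦ (ρ b).continuous.isOpen_support).measurableSet

variable {d : ℕ} {X : Type v} [TopologicalSpace X] [ChartedSpace (EuclideanSpace ℝ (Fin d)) X]

variable (d) in
/-- The uniform probability measure on the ball of radius `r` about `y`, in the chart at `c`. -/
def chartBallMeasure (c : X) (r : ℝ) (y : X) : Measure (EuclideanSpace ℝ (Fin d)) :=
  ProbabilityTheory.cond volume (Metric.ball (chartAt (EuclideanSpace ℝ (Fin d)) c y) r ∩
    (chartAt (EuclideanSpace ℝ (Fin d)) c).target)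

theorem isProbabilityMeasure_chartBallMeasure {c y : X} {r : ℝ} (hr : 0 < r)
    (hy : y ∈ (chartAt (EuclideanSpace ℝ (Fin d)) c).source) :
    IsProbabilityMeasure (chartBallMeasure d c r y) := by
  refine ProbabilityTheory.cond_isProbabilityMeasure_of_finite ?_ ?_
  · exact ((Metric.isOpen_ball.inter (chartAt _ c).open_target).measure_pos _
      ⟨_, Metric.mem_ball_self hr, OpenPartialHomeomorph.map_source _ hy⟩).ne'
  · exact ((measure_mono Set.inter_subset_left).trans_lt measure_ball_lt_top).ne

theorem chartBallMeasure_absolutelyContinuous (c : X) (r : ℝ) (y : X) :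
    chartBallMeasure d c r y ≪ volume.restrict (chartAt (EuclideanSpace ℝ (Fin d)) c).target :=
  (Measure.restrict_mono Set.inter_subset_right le_rfl).absolutelyContinuous.smul_left _

variable {𝕜 : Type*} [RCLike 𝕜]

variable (d) in
/-- The average of `f` over a ball of radius `r` about `y`, in the chart at `j y`. -/
def chartAverage (j : X → X) (r : ℝ) (f : X → 𝕜) (y : X) : 𝕜 :=
  ∫ p, f ((chartAt (EuclideanSpace ℝ (Fin d)) (j y)).symm p) ∂(chartBallMeasure d (j y) r y)

variable {j : X → X} {r : ℝ} {f f' : X → 𝕜} {y : X}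

theorem chartAverage_congr (h : IsLocNull d {x | f x ≠ f' x}) :
    chartAverage d j r f y = chartAverage d j r f' y := by
  refine integral_congr_ae ((chartBallMeasure_absolutelyContinuous _ _ _).ae_le ?_)
  refine (ae_restrict_iff' (chartAt _ (j y)).open_target.measurableSet).2 (ae_iff.2 ?_)
  refine measure_mono_null ?_ (h (j y))
  intro p hp
  simpa using hp

theorem norm_chartAverage_le (hr : 0 < r)
    (hy : y ∈ (chartAt (EuclideanSpace ℝ (Fin d)) (j y)).source) {C : ℝ} (hC : ∀ x, ‖f x‖ ≤ C) :
    ‖chartAverage d j r f y‖ ≤ C := by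
  have := isProbabilityMeasure_chartBallMeasure hr hy
  simpa [chartAverage] using norm_integral_le_of_norm_le_const (μ := chartBallMeasure d (j y) r y)
    (Filter.Eventually.of_forall fun p ↦
      hC ((chartAt (EuclideanSpace ℝ (Fin d)) (j y)).symm p))

theorem chartAverage_nonneg (hf : ∀ x, 0 ≤ f x) : 0 ≤ chartAverage d j r f y :=
  integral_nonneg fun _ ↦ hf _

theorem chartAverage_smul (a : 𝕜) : chartAverage d j r (a • f) y = a • chartAverage d j r f y :=
  integral_smul a _

variable [MeasurableSpace X] [BorelSpace X]

theorem integrable_chartBallMeasure (hr : 0 < r) {c : X}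
    (hy : y ∈ (chartAt (EuclideanSpace ℝ (Fin d)) c).source) (hf : Measurable f) {C : ℝ}
    (hC : ∀ x, ‖f x‖ ≤ C) :
    Integrable (fun p ↦ f ((chartAt (EuclideanSpace ℝ (Fin d)) c).symm p))
      (chartBallMeasure d c r y) := by
  have := isProbabilityMeasure_chartBallMeasure hr hy
  refine Integrable.of_bound ?_ C (Filter.Eventually.of_forall fun p ↦ hC _)
  have h := ((chartAt (EuclideanSpace ℝ (Fin d)) c).continuousOn_symm.aemeasurable (μ := volume)
    (chartAt (EuclideanSpace ℝ (Fin d)) c).open_target.measurableSet)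
  exact (hf.comp_aemeasurable
    (h.mono_ac (chartBallMeasure_absolutelyContinuous c r y))).aestronglyMeasurable

theorem chartAverage_add (hr : 0 < r)
    (hy : y ∈ (chartAt (EuclideanSpace ℝ (Fin d)) (j y)).source)
    (hf : Measurable f) (hf' : Measurable f') {C C' : ℝ}
    (hC : ∀ x, ‖f x‖ ≤ C) (hC' : ∀ x, ‖f' x‖ ≤ C') :
    chartAverage d j r (f + f') y = chartAverage d j r f y + chartAverage d j r f' y :=
  integral_add (integrable_chartBallMeasure hr hy hf hC) (integrable_chartBallMeasure hr hy hf' hC')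

theorem tendsto_chartAverage
    (hy : y ∈ (chartAt (EuclideanSpace ℝ (Fin d)) (j y)).source)
    (hf : Measurable f) {C : ℝ} (hC : ∀ x, ‖f x‖ ≤ C) {a : 𝕜}
    (h : Filter.Tendsto (fun r : ℝ ↦
      (∫⁻ p in Metric.ball (chartAt (EuclideanSpace ℝ (Fin d)) (j y) y) r,
        ‖f ((chartAt (EuclideanSpace ℝ (Fin d)) (j y)).symm p) - a‖ₑ) /
      volume (Metric.ball (chartAt (EuclideanSpace ℝ (Fin d)) (j y) y) r)) (𝓝[>] 0) (𝓝 0)) :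
    Filter.Tendsto (fun r ↦ chartAverage d j r f y) (𝓝[>] 0) (𝓝 a) := by
  rw [tendsto_iff_edist_tendsto_0]
  refine tendsto_of_tendsto_of_tendsto_of_le_of_le' tendsto_const_nhds h
    (Filter.Eventually.of_forall fun _ ↦ zero_le) ?_
  have hp := OpenPartialHomeomorph.map_source _ hy
  obtain ⟨δ, hδ, hδT⟩ := Metric.isOpen_iff.1
    (chartAt (EuclideanSpace ℝ (Fin d)) (j y)).open_target _ hp
  have hsmall : ∀ᶠ r in 𝓝[>] (0 : ℝ), r < δ := nhdsWithin_le_nhds (gt_mem_nhds hδ)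
  filter_upwards [hsmall, self_mem_nhdsWithin] with r hr hr0
  have hr0' : 0 < r := hr0
  have hprob := isProbabilityMeasure_chartBallMeasure hr0' hy
  have hmeas : chartBallMeasure d (j y) r y = ProbabilityTheory.cond volume
      -- For `r < δ` the ball lies in the chart target, so the truncation in `chartBallMeasure` has
      -- no effect.
      (Metric.ball (chartAt (EuclideanSpace ℝ (Fin d)) (j y) y) r) := by
    rw [chartBallMeasure, Set.inter_eq_left.2 ((Metric.ball_subset_ball hr.le).trans hδT)]
  have hsub : chartAverage d j r f y - a =
      ∫ p, (f ((chartAt (EuclideanSpace ℝ (Fin d)) (j y)).symm p) - a)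
        ∂(chartBallMeasure d (j y) r y) := by
    rw [integral_sub (integrable_chartBallMeasure hr0' hy hf hC) (integrable_const a)]
    simp [chartAverage]
  rw [edist_eq_enorm_sub, hsub]
  refine (enorm_integral_le_lintegral_enorm _).trans_eq ?_
  rw [hmeas, ProbabilityTheory.cond, lintegral_smul_measure, smul_eq_mul, mul_comm, div_eq_mul_inv]

theorem tendsto_chartAverage_of_continuous
    (hy : y ∈ (chartAt (EuclideanSpace ℝ (Fin d)) (j y)).source)
    (hf : Continuous f) {C : ℝ} (hC : ∀ x, ‖f x‖ ≤ C) :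
    Filter.Tendsto (fun r ↦ chartAverage d j r f y) (𝓝[>] 0) (𝓝 (f y)) := by
  refine tendsto_chartAverage hy hf.measurable hC ?_
  refine ENNReal.tendsto_nhds_zero.2 fun ε hε ↦ ?_
  have hp := OpenPartialHomeomorph.map_source _ hy
  have hcont : ContinuousAt (fun p ↦ ‖f ((chartAt (EuclideanSpace ℝ (Fin d)) (j y)).symm p)
      - f y‖ₑ) (chartAt (EuclideanSpace ℝ (Fin d)) (j y) y) :=
    ((hf.continuousAt.comp (OpenPartialHomeomorph.continuousAt_symm _ hp)).sub
      continuousAt_const).enorm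
  have hev : ∀ᶠ p in 𝓝 (chartAt (EuclideanSpace ℝ (Fin d)) (j y) y),
      ‖f ((chartAt (EuclideanSpace ℝ (Fin d)) (j y)).symm p) - f y‖ₑ ≤ ε :=
    Filter.Tendsto.eventually_le_const (by simpa [OpenPartialHomeomorph.left_inv _ hy] using hε)
      hcont
  obtain ⟨δ, hδ, H⟩ := Metric.eventually_nhds_iff_ball.1 hev
  have hsmall : ∀ᶠ r in 𝓝[>] (0 : ℝ), r < δ := nhdsWithin_le_nhds (gt_mem_nhds hδ)
  filter_upwards [hsmall] with r hr
  refine ENNReal.div_le_of_le_mul ?_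
  refine (setLIntegral_mono measurable_const fun p hp ↦
    H p (Metric.ball_subset_ball hr.le hp)).trans_eq ?_
  simp

end LocalAverages

/-! ### Local averages of translates at Lebesgue points. -/

section GroupAverages

variable {d : ℕ} {X : Type v} [TopologicalSpace X] [ChartedSpace (EuclideanSpace ℝ (Fin d)) X]
  {𝕜 : Type*} [RCLike 𝕜]

variable (d) in
/-- The function `f` read in the chart at `c`, extended by zero. -/
def chartRead (c : X) (f : X → 𝕜) : EuclideanSpace ℝ (Fin d) → 𝕜 :=
  (chartAt (EuclideanSpace ℝ (Fin d)) c).target.indicator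
    (f ∘ (chartAt (EuclideanSpace ℝ (Fin d)) c).symm)

variable (d) in
/-- `x` is a Lebesgue point of `f` in some preferred chart. -/
def IsChartLebesguePoint (f : X → 𝕜) (x : X) : Prop :=
  ∃ c : X, x ∈ (chartAt (EuclideanSpace ℝ (Fin d)) c).source ∧
    IsLebesguePoint (chartRead d c f) (chartAt (EuclideanSpace ℝ (Fin d)) c x)

section Borel

variable [MeasurableSpace X] [BorelSpace X]

theorem measurable_chartRead (c : X) {f : X → 𝕜} (hf : Measurable f) :
    Measurable (chartRead d c f) :=
  measurable_indicator_comp_of_continuousOn hf (OpenPartialHomeomorph.open_target _).measurableSet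
    (OpenPartialHomeomorph.continuousOn_symm _)

theorem isLocNull_not_isChartLebesguePoint {f : X → 𝕜} (hf : Measurable f) {C : ℝ}
    (hC : ∀ x, ‖f x‖ ≤ C) : IsLocNull d {x | ¬ IsChartLebesguePoint d f x} := by
  intro c
  have hloc : LocallyIntegrable (chartRead d c f) := by
    refine (memLp_top_of_bound (measurable_chartRead c hf).aestronglyMeasurable C
      (Filter.Eventually.of_forall fun p ↦ ?_)).locallyIntegrable le_top
    exact (norm_indicator_le_norm_self _ _).trans (hC _)
  refine measure_mono_null ?_ (ae_iff.1 (ae_isLebesguePoint hloc))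
  rintro p ⟨hp, hpn⟩ hleb
  refine hpn ⟨c, OpenPartialHomeomorph.map_target _ hp, ?_⟩
  rwa [OpenPartialHomeomorph.right_inv _ hp]

end Borel

variable {G : Type u} [Group G] [TopologicalSpace G] [IsManifold (𝓡 d) 1 X] [MulAction G X]

theorem IsC1ContinuousAction.continuous_const_smul (h : IsC1ContinuousAction G d X) (g : G) :
    Continuous fun x : X ↦ g • x :=
  h.continuous_smul.comp (Continuous.prodMk_right g)

theorem IsC1ContinuousAction.continuous_tangentMap_const (h : IsC1ContinuousAction G d X) (g : G) :
    Continuous (tangentMap (𝓡 d) (𝓡 d) fun x : X ↦ g • x) :=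
  h.continuous_tangentMap.comp (Continuous.prodMk_right g)

theorem IsLocNull.preimage_smul (h : IsC1ContinuousAction G d X) (g : G) {A : Set X}
    (hA : IsLocNull d A) : IsLocNull d ((fun x ↦ g • x) ⁻¹' A) :=
  hA.preimage (h.mdifferentiable g⁻¹) (h.continuous_const_smul g) (inv_smul_smul g)

variable [MeasurableSpace X] [BorelSpace X]

/-- The chart chosen at `g⁻¹ • x` and the chart in which `x` is a Lebesgue point are unrelated. Read
in these charts, `g` and `g⁻¹` are locally Lipschitz, so the oscillation of `f ∘ g` near `g⁻¹ • x`
is controlled by that of `f` near `x`. -/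
theorem tendsto_chartAverage_smul (hG : IsC1ContinuousAction G d X) {j : X → X}
    (hj : ∀ y, y ∈ (chartAt (EuclideanSpace ℝ (Fin d)) (j y)).source) {f : X → 𝕜}
    (hf : Measurable f) {C : ℝ} (hC : ∀ x, ‖f x‖ ≤ C) {x : X}
    (hx : IsChartLebesguePoint d f x) (g : G) :
    Filter.Tendsto (fun r ↦ chartAverage d j r (fun z ↦ f (g • z)) (g⁻¹ • x)) (𝓝[>] 0)
      (𝓝 (f x)) := by
  obtain ⟨c, hxc, hleb⟩ := hx
  set y := g⁻¹ • x with hy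
  have hgy : g • y = x := smul_inv_smul g x
  set e := chartAt (EuclideanSpace ℝ (Fin d)) (j y) with he
  set e' := chartAt (EuclideanSpace ℝ (Fin d)) c with he'
  have hye : y ∈ e.source := hj y
  have hee : e ∈ atlas (EuclideanSpace ℝ (Fin d)) X := chart_mem_atlas _ _
  have hee' : e' ∈ atlas (EuclideanSpace ℝ (Fin d)) X := chart_mem_atlas _ _
  have hp : e y ∈ e.target := e.map_source hye
  have hq : e' x ∈ e'.target := e'.map_source hxc
  have hsp : g • e.symm (e y) = x := by rw [e.left_inv hye, hgy]
  have hsq : g⁻¹ • e'.symm (e' x) = y := by rw [e'.left_inv hxc]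
  obtain ⟨K, δ₁, hδ₁, hK⟩ := transition_locallyLipschitz hee hee' (hG.mdifferentiable g)
    (hG.continuous_tangentMap_const g) hp (by rw [hsp]; exact hxc)
  obtain ⟨L, δ₂, hδ₂, hL⟩ := transition_locallyLipschitz hee' hee (hG.mdifferentiable g⁻¹)
    (hG.continuous_tangentMap_const g⁻¹) hq (by rw [hsq]; exact hye)
  have hθp : (e' ∘ (fun z : X ↦ g • z) ∘ e.symm) (e y) = e' x := by
    simp only [Function.comp_apply, hsp]
  have hev : ∀ᶠ p in 𝓝 (e y), p ∈ e.target ∧ g • e.symm p ∈ e'.source := by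
    refine (e.open_target.eventually_mem hp).and ?_
    refine ((hG.continuous_const_smul g).continuousAt.comp (e.continuousAt_symm hp)).eventually
      (e'.open_source.eventually_mem ?_)
    simpa [hsp] using hxc
  obtain ⟨δ₃, hδ₃, H⟩ := Metric.eventually_nhds_iff_ball.1 hev
  have hδ : 0 < min δ₁ (min δ₂ δ₃) := lt_min hδ₁ (lt_min hδ₂ hδ₃)
  have hread : ∀ z ∈ e'.source, chartRead d c f (e' z) = f z := fun z hz ↦ by
    rw [chartRead, Set.indicator_of_mem (e'.map_source hz), Function.comp_apply, e'.left_inv hz]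
  have key := tendsto_average_comp_of_lipschitz_inverse hδ
    (θ := e' ∘ (fun z : X ↦ g • z) ∘ e.symm) (τ := e ∘ (fun z : X ↦ g⁻¹ • z) ∘ e'.symm)
    (hK.mono (Metric.ball_subset_ball (min_le_left _ _)))
    (by
      rw [hθp]
      exact hL.mono (Metric.ball_subset_ball ((min_le_right _ _).trans (min_le_left _ _))))
    (fun p hp ↦ by
      have h3 := H p (Metric.ball_subset_ball ((min_le_right _ _).trans (min_le_right _ _)) hp)
      simp only [Function.comp_apply, e'.left_inv h3.2, inv_smul_smul, e.right_inv h3.1])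
    (h := fun z ↦ ‖chartRead d c f z - chartRead d c f (e' x)‖ₑ)
    ((measurable_chartRead c hf).sub_const _).enorm
    (by rw [hθp]; exact hleb)
  refine tendsto_chartAverage (hj y) (hf.comp (hG.continuous_const_smul g).measurable)
    (fun z ↦ hC _) (key.congr' ?_)
  have hsmall : ∀ᶠ r in 𝓝[>] (0 : ℝ), r < δ₃ := nhdsWithin_le_nhds (gt_mem_nhds hδ₃)
  filter_upwards [hsmall] with r hr
  congr 1
  refine setLIntegral_congr_fun measurableSet_ball fun p hp ↦ ?_
  have h3 := H p (Metric.ball_subset_ball hr.le hp)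
  change ‖chartRead d c f (e' (g • e.symm p)) - chartRead d c f (e' x)‖ₑ =
    ‖f (g • e.symm p) - f x‖ₑ
  rw [hread _ h3.2, hread x hxc]

theorem tendsto_chartAverage_smul_of_continuous (hG : IsC1ContinuousAction G d X) {j : X → X}
    (hj : ∀ y, y ∈ (chartAt (EuclideanSpace ℝ (Fin d)) (j y)).source) {f : X → 𝕜}
    (hf : Continuous f) {C : ℝ} (hC : ∀ x, ‖f x‖ ≤ C) (x : X) (g : G) :
    Filter.Tendsto (fun r ↦ chartAverage d j r (fun z ↦ f (g • z)) (g⁻¹ • x)) (𝓝[>] 0)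
      (𝓝 (f x)) := by
  have h := tendsto_chartAverage_of_continuous (f := fun z ↦ f (g • z)) (hj (g⁻¹ • x))
    (hf.comp (hG.continuous_const_smul g)) (fun z ↦ hC (g • z))
  rwa [smul_inv_smul] at h

end GroupAverages

/-! ### Measurability of the averages in the group variable. -/

section Measurability

theorem continuous_inv_smul_const {G X : Type*} [Group G] [TopologicalSpace G]
    [IsTopologicalGroup G] [TopologicalSpace X] [MulAction G X]
    (hcont : Continuous fun p : G × X ↦ p.1 • p.2) (x : X) :
    Continuous fun g : G ↦ g⁻¹ • x :=
  hcont.comp (continuous_inv.prodMk continuous_const)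

variable {G : Type u} [Group G] [TopologicalSpace G] [IsTopologicalGroup G]
  [MeasurableSpace G] [BorelSpace G]
  {d : ℕ} {X : Type v} [TopologicalSpace X] [ChartedSpace (EuclideanSpace ℝ (Fin d)) X]
  [MulAction G X] {𝕜 : Type*} [RCLike 𝕜]

/-- The integrals of `m g * ρ c (g⁻¹ • x)` have finite partial sums at most `∫ m`, so only countably
many are nonzero. Haar measure charges open sets, so a vanishing integral of a continuous
non-negative function forces that function to vanish. -/
theorem countable_support_mul_partitionOfUnity [LocallyCompactSpace G]
    (hcont : Continuous fun p : G × X ↦ p.1 • p.2) (ρ : PartitionOfUnity X X) (x : X) {m : G → ℝ}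
    (hm : Continuous m) (hm0 : ∀ g, 0 ≤ m g) (hmint : Integrable m Measure.haar) :
    {c : X | ∃ g, m g ≠ 0 ∧ ρ c (g⁻¹ • x) ≠ 0}.Countable := by
  have hρ : ∀ c, Continuous fun g : G ↦ ρ c (g⁻¹ • x) := fun c ↦
    (ρ c).continuous.comp (continuous_inv_smul_const hcont x)
  have hint : ∀ c, Integrable (fun g ↦ m g * ρ c (g⁻¹ • x)) Measure.haar := fun c ↦ by
    refine hmint.mul_bdd (c := 1) (hρ c).aestronglyMeasurable
      (Filter.Eventually.of_forall fun g ↦ ?_)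
    rw [Real.norm_of_nonneg (ρ.nonneg c _)]
    exact ρ.le_one c _
  have hsum : Summable fun c ↦ ∫ g, m g * ρ c (g⁻¹ • x) ∂Measure.haar := by
    refine summable_of_sum_le (c := ∫ g, m g ∂Measure.haar)
      (fun c ↦ integral_nonneg fun g ↦ mul_nonneg (hm0 g) (ρ.nonneg c _)) fun s ↦ ?_
    rw [← integral_finsetSum s fun c _ ↦ hint c]
    refine integral_mono (integrable_finsetSum s fun c _ ↦ hint c) hmint fun g ↦ ?_
    rw [← Finset.mul_sum]
    refine mul_le_of_le_one_right (hm0 g) ?_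
    classical
    rw [← ρ.sum_finsupport' (Set.mem_univ (g⁻¹ • x)) (Finset.subset_union_right (s₁ := s))]
    exact Finset.sum_le_sum_of_subset_of_nonneg Finset.subset_union_left
      fun c _ _ ↦ ρ.nonneg c _
  refine hsum.countable_support.mono ?_
  rintro c ⟨g, hg, hg'⟩
  refine (integral_pos_of_integrable_nonneg_nonzero (hm.mul (hρ c)) (hint c)
    (fun g ↦ mul_nonneg (hm0 g) (ρ.nonneg c _)) (mul_ne_zero hg hg')).ne'

variable [MeasurableSpace X] [BorelSpace X]

/-- The ball moves with `g`, so both the integral and the normalising volume are written as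
integrals over slices of one open set in `G × ℝᵈ`. Since `ℝᵈ` is second countable, Borel sets of
this product are measurable for the product σ-algebra. -/
theorem exists_measurable_integral_chartBallMeasure
    (hcont : Continuous fun p : G × X ↦ p.1 • p.2) (c : X) (r : ℝ) {f : X → 𝕜}
    (hf : Measurable f) (x : X) :
    ∃ F : G → 𝕜, Measurable F ∧
      ∀ g : G, g⁻¹ • x ∈ (chartAt (EuclideanSpace ℝ (Fin d)) c).source →
        F g = ∫ p, f (g • (chartAt (EuclideanSpace ℝ (Fin d)) c).symm p)
          ∂(chartBallMeasure d c r (g⁻¹ • x)) := by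
  set e := chartAt (EuclideanSpace ℝ (Fin d)) c with he
  have hinv : Continuous fun q : G × EuclideanSpace ℝ (Fin d) ↦ q.1⁻¹ • x :=
    (continuous_inv_smul_const hcont x).comp continuous_fst
  let O : Set (G × EuclideanSpace ℝ (Fin d)) := {q | q.1⁻¹ • x ∈ e.source}
  have hO : IsOpen O := e.open_source.preimage hinv
  let Ω : Set (G × EuclideanSpace ℝ (Fin d)) :=
    (O ∩ {q | dist q.2 (e (q.1⁻¹ • x)) < r}) ∩ {q | q.2 ∈ e.target}
  have hΩ : IsOpen Ω := by
    refine IsOpen.inter ?_ (e.open_target.preimage continuous_snd)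
    have : ContinuousOn (fun q : G × EuclideanSpace ℝ (Fin d) ↦ dist q.2 (e (q.1⁻¹ • x))) O :=
      continuous_dist.comp_continuousOn (continuous_snd.continuousOn.prodMk
        (e.continuousOn.comp hinv.continuousOn fun q hq ↦ hq))
    exact this.isOpen_inter_preimage hO isOpen_Iio
  have hact : ContinuousOn (fun q : G × EuclideanSpace ℝ (Fin d) ↦ q.1 • e.symm q.2) Ω :=
    hcont.comp_continuousOn (continuous_fst.continuousOn.prodMk
      (e.continuousOn_symm.comp continuous_snd.continuousOn fun q hq ↦ hq.2))
  have hΦ : Measurable (Ω.indicator (f ∘ fun q ↦ q.1 • e.symm q.2)) :=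
    measurable_indicator_comp_of_continuousOn hf hΩ.measurableSet hact
  have hΦ₁ : Measurable (Ω.indicator (fun _ ↦ (1 : ℝ))) :=
    measurable_const.indicator hΩ.measurableSet
  refine ⟨fun g ↦ (∫ p, Ω.indicator (fun _ ↦ (1 : ℝ)) (g, p))⁻¹ •
    ∫ p, Ω.indicator (f ∘ fun q ↦ q.1 • e.symm q.2) (g, p), ?_, fun g hg ↦ ?_⟩
  · exact (hΦ₁.stronglyMeasurable.integral_prod_right'.measurable.inv).smul
      hΦ.stronglyMeasurable.integral_prod_right'.measurable
  · let s : Set (EuclideanSpace ℝ (Fin d)) := Metric.ball (e (g⁻¹ • x)) r ∩ e.target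
    have hs : MeasurableSet s := measurableSet_ball.inter e.open_target.measurableSet
    have hmem : ∀ p, (g, p) ∈ Ω ↔ p ∈ s := fun p ↦
      ⟨fun h ↦ ⟨h.1.2, h.2⟩, fun h ↦ ⟨⟨hg, h.1⟩, h.2⟩⟩
    have h₁ : (fun p ↦ Ω.indicator (fun _ ↦ (1 : ℝ)) (g, p)) = s.indicator fun _ ↦ 1 := by
      ext p
      by_cases hp : p ∈ s
      · rw [Set.indicator_of_mem hp, Set.indicator_of_mem ((hmem p).2 hp)]
      · rw [Set.indicator_of_notMem hp, Set.indicator_of_notMem (mt (hmem p).1 hp)]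
    have h₂ : (fun p ↦ Ω.indicator (f ∘ fun q ↦ q.1 • e.symm q.2) (g, p)) =
        s.indicator fun p ↦ f (g • e.symm p) := by
      ext p
      by_cases hp : p ∈ s
      · rw [Set.indicator_of_mem hp, Set.indicator_of_mem ((hmem p).2 hp)]; rfl
      · rw [Set.indicator_of_notMem hp, Set.indicator_of_notMem (mt (hmem p).1 hp)]
    simp only [h₁, h₂]
    rw [integral_indicator hs, integral_indicator hs, chartBallMeasure, ProbabilityTheory.cond,
      integral_smul_measure]
    simp [s, he, Measure.real]

theorem aestronglyMeasurable_smul_chartAverage [LocallyCompactSpace G]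
    (hcont : Continuous fun p : G × X ↦ p.1 • p.2) (ρ : PartitionOfUnity X X)
    (hρ : ∀ c x, ρ c x ≠ 0 → x ∈ (chartAt (EuclideanSpace ℝ (Fin d)) c).source)
    {j : X → X} (hj : ∀ y, ρ (j y) y ≠ 0) (hjm : ∀ c, MeasurableSet {y | j y = c})
    (x : X) {m : G → ℝ}
    (hm : Continuous m) (hm0 : ∀ g, 0 ≤ m g) (hmint : Integrable m Measure.haar)
    (r : ℝ) {f : X → 𝕜} (hf : Measurable f) :
    AEStronglyMeasurable (fun g ↦ m g • chartAverage d j r (fun z ↦ f (g • z)) (g⁻¹ • x))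
      Measure.haar := by
  set J := {c : X | ∃ g, m g ≠ 0 ∧ ρ c (g⁻¹ • x) ≠ 0} with hJ
  have hJc : J.Countable := countable_support_mul_partitionOfUnity hcont ρ x hm hm0 hmint
  have := hJc.to_subtype
  -- A countable measurable cover of `G`: the integrand vanishes on the piece `none`, and on each
  -- other piece the chart is fixed.
  let S : Option J → Set G := fun o ↦ o.elim {g | m g = 0} fun c ↦ {g | j (g⁻¹ • x) = c}
  have hS : ⋃ o, S o = Set.univ := by
    refine Set.eq_univ_of_forall fun g ↦ ?_
    by_cases hg : m g = 0
    · exact Set.mem_iUnion.2 ⟨none, hg⟩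
    · exact Set.mem_iUnion.2 ⟨some ⟨j (g⁻¹ • x), g, hg, hj _⟩, rfl⟩
  rw [← Measure.restrict_univ (μ := Measure.haar), ← hS, aestronglyMeasurable_iUnion_iff]
  rintro (_ | c)
  · refine (aestronglyMeasurable_const (b := (0 : 𝕜))).congr ?_
    have hmeas : MeasurableSet (S none) := (isClosed_singleton.preimage hm).measurableSet
    filter_upwards [ae_restrict_mem hmeas] with g hg
    rw [show m g = 0 from hg, zero_smul]
  · obtain ⟨F, hF, hFeq⟩ := exists_measurable_integral_chartBallMeasure (d := d) hcont c r hf x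
    have hmeas : MeasurableSet (S (some c)) :=
      (continuous_inv_smul_const hcont x).measurable (hjm c)
    refine ((hm.measurable.smul hF).aestronglyMeasurable).congr ?_
    filter_upwards [ae_restrict_mem hmeas] with g hg
    have hg' : j (g⁻¹ • x) = c := hg
    have hsrc : g⁻¹ • x ∈ (chartAt (EuclideanSpace ℝ (Fin d)) (c : X)).source := by
      rw [← hg']; exact hρ _ _ (hj _)
    simp only [Pi.smul_apply', hFeq g hsrc, chartAverage, hg']

end Measurability

/-! ### Weighted averages over the group. -/

section GroupAverages

variable {G : Type u} [Group G] [TopologicalSpace G] [IsTopologicalGroup G]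
  [LocallyCompactSpace G] [MeasurableSpace G] [BorelSpace G]
  {d : ℕ} {X : Type v} [TopologicalSpace X] [ChartedSpace (EuclideanSpace ℝ (Fin d)) X]
  [MulAction G X] {𝕜 : Type*} [RCLike 𝕜]

variable (d) in
/-- The average over `G`, with weight `m`, of the translates of the local averages of `f`. -/
def groupAverage (j : X → X) (m : G → ℝ) (r : ℝ) (f : X → 𝕜) (x : X) : 𝕜 :=
  ∫ g, m g • chartAverage d j r (fun z ↦ f (g • z)) (g⁻¹ • x) ∂Measure.haar

variable {j : X → X} {m m' : G → ℝ} {r : ℝ} {f f' : X → 𝕜} {C C' : ℝ} {x : X}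

theorem groupAverage_smul (a : 𝕜) :
    groupAverage d j m r (a • f) x = a • groupAverage d j m r f x := by
  rw [groupAverage, groupAverage, ← integral_smul]
  congr 1
  ext g
  rw [smul_comm a, ← chartAverage_smul]
  rfl

theorem groupAverage_nonneg (hm0 : ∀ g, 0 ≤ m g) (hf : ∀ x, 0 ≤ f x) :
    0 ≤ groupAverage d j m r f x :=
  integral_nonneg fun g ↦ smul_nonneg (hm0 g) (chartAverage_nonneg fun z ↦ hf (g • z))

theorem norm_groupAverage_le (hj : ∀ y, y ∈ (chartAt (EuclideanSpace ℝ (Fin d)) (j y)).source)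
    (hr : 0 < r) (hm0 : ∀ g, 0 ≤ m g) (hm : ∫ g, m g ∂Measure.haar = 1) (hC : ∀ x, ‖f x‖ ≤ C) :
    ‖groupAverage d j m r f x‖ ≤ C := by
  have hmint : Integrable m Measure.haar := .of_integral_ne_zero (by rw [hm]; exact one_ne_zero)
  refine (norm_integral_le_of_norm_le (hmint.mul_const C)
    (Filter.Eventually.of_forall fun g ↦ ?_)).trans_eq ?_
  · rw [norm_smul, Real.norm_of_nonneg (hm0 g)]
    exact mul_le_mul_of_nonneg_left (norm_chartAverage_le hr (hj _) fun z ↦ hC _) (hm0 g)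
  · rw [integral_mul_const, hm, one_mul]

theorem groupAverage_translate (s : G) (x : X) :
    groupAverage d j m r (fun z ↦ f (s⁻¹ • z)) x =
      groupAverage d j (fun g ↦ m (s * g)) r f (s⁻¹ • x) := by
  rw [groupAverage, groupAverage, ← integral_mul_left_eq_self
    (fun g ↦ m (s * g) • chartAverage d j r (fun z ↦ f (g • z)) (g⁻¹ • s⁻¹ • x)) s⁻¹]
  simp only [mul_inv_cancel_left, mul_inv_rev, inv_inv, mul_smul, smul_inv_smul]

/-- Each `g` preserves locally null sets, so the integrands agree for every single `g` and no Fubini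
argument is needed. -/
theorem groupAverage_congr [IsManifold (𝓡 d) 1 X] (hG : IsC1ContinuousAction G d X)
    (h : IsLocNull d {x | f x ≠ f' x}) :
    groupAverage d j m r f x = groupAverage d j m r f' x := by
  unfold groupAverage
  congr 1
  ext g
  rw [chartAverage_congr (h.preimage_smul hG g)]

variable [MeasurableSpace X] [BorelSpace X] {ρ : PartitionOfUnity X X}

theorem integrable_groupAverage (hcont : Continuous fun p : G × X ↦ p.1 • p.2)
    (hρ : ∀ c x, ρ c x ≠ 0 → x ∈ (chartAt (EuclideanSpace ℝ (Fin d)) c).source)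
    (hj : ∀ y, ρ (j y) y ≠ 0) (hjm : ∀ c, MeasurableSet {y | j y = c})
    (hm : Continuous m) (hm0 : ∀ g, 0 ≤ m g) (hmint : Integrable m Measure.haar)
    (hr : 0 < r) (hf : Measurable f) (hC : ∀ x, ‖f x‖ ≤ C) :
    Integrable (fun g ↦ m g • chartAverage d j r (fun z ↦ f (g • z)) (g⁻¹ • x)) Measure.haar := by
  refine (hmint.mul_const C).mono'
    (aestronglyMeasurable_smul_chartAverage hcont ρ hρ hj hjm x hm hm0 hmint r hf)
    (Filter.Eventually.of_forall fun g ↦ ?_)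
  rw [norm_smul, Real.norm_of_nonneg (hm0 g)]
  exact mul_le_mul_of_nonneg_left
    (norm_chartAverage_le hr (hρ _ _ (hj _)) fun z ↦ hC _) (hm0 g)

theorem groupAverage_add (hcont : Continuous fun p : G × X ↦ p.1 • p.2)
    (hρ : ∀ c x, ρ c x ≠ 0 → x ∈ (chartAt (EuclideanSpace ℝ (Fin d)) c).source)
    (hj : ∀ y, ρ (j y) y ≠ 0) (hjm : ∀ c, MeasurableSet {y | j y = c})
    (hm : Continuous m) (hm0 : ∀ g, 0 ≤ m g) (hmint : Integrable m Measure.haar)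
    (hr : 0 < r) (hf : Measurable f) (hC : ∀ x, ‖f x‖ ≤ C)
    (hf' : Measurable f') (hC' : ∀ x, ‖f' x‖ ≤ C') :
    groupAverage d j m r (f + f') x = groupAverage d j m r f x + groupAverage d j m r f' x := by
  rw [groupAverage, groupAverage, groupAverage, ← integral_add
    (integrable_groupAverage hcont hρ hj hjm hm hm0 hmint hr hf hC)
    (integrable_groupAverage hcont hρ hj hjm hm hm0 hmint hr hf' hC')]
  congr 1
  ext g
  have hg : Measurable fun z : X ↦ g • z :=
    (hcont.comp (Continuous.prodMk_right g)).measurable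
  rw [← smul_add]
  exact congrArg (m g • ·) (chartAverage_add hr (hρ _ _ (hj _)) (hf.comp hg) (hf'.comp hg)
    (fun z ↦ hC _) (fun z ↦ hC' _))

/-- The bound does not involve `r`, so it survives the limit over radii. -/
theorem norm_groupAverage_sub_le (hcont : Continuous fun p : G × X ↦ p.1 • p.2)
    (hρ : ∀ c x, ρ c x ≠ 0 → x ∈ (chartAt (EuclideanSpace ℝ (Fin d)) c).source)
    (hj : ∀ y, ρ (j y) y ≠ 0) (hjm : ∀ c, MeasurableSet {y | j y = c})
    (hm : Continuous m) (hm0 : ∀ g, 0 ≤ m g) (hmint : Integrable m Measure.haar)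
    (hm' : Continuous m') (hm0' : ∀ g, 0 ≤ m' g) (hmint' : Integrable m' Measure.haar)
    (hr : 0 < r) (hf : Measurable f) (hC : ∀ x, ‖f x‖ ≤ C) :
    ‖groupAverage d j m r f x - groupAverage d j m' r f x‖ ≤
      (∫ g, |m g - m' g| ∂Measure.haar) * C := by
  rw [groupAverage, groupAverage, ← integral_sub
    (integrable_groupAverage hcont hρ hj hjm hm hm0 hmint hr hf hC)
    (integrable_groupAverage hcont hρ hj hjm hm' hm0' hmint' hr hf hC), ← integral_mul_const]
  refine norm_integral_le_of_norm_le ((hmint.sub hmint').abs.mul_const C)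
    (Filter.Eventually.of_forall fun g ↦ ?_)
  rw [← sub_smul, norm_smul, Real.norm_eq_abs]
  exact mul_le_mul_of_nonneg_left
    (norm_chartAverage_le hr (hρ _ _ (hj _)) fun z ↦ hC _) (abs_nonneg _)

theorem tendsto_groupAverage (hcont : Continuous fun p : G × X ↦ p.1 • p.2)
    (hρ : ∀ c x, ρ c x ≠ 0 → x ∈ (chartAt (EuclideanSpace ℝ (Fin d)) c).source)
    (hj : ∀ y, ρ (j y) y ≠ 0) (hjm : ∀ c, MeasurableSet {y | j y = c})
    (hm : Continuous m) (hm0 : ∀ g, 0 ≤ m g) (hm1 : ∫ g, m g ∂Measure.haar = 1)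
    (hf : Measurable f) (hC : ∀ x, ‖f x‖ ≤ C)
    (hlim : ∀ g : G, Filter.Tendsto
      (fun r ↦ chartAverage d j r (fun z ↦ f (g • z)) (g⁻¹ • x)) (𝓝[>] 0) (𝓝 (f x))) :
    Filter.Tendsto (fun r ↦ groupAverage d j m r f x) (𝓝[>] 0) (𝓝 (f x)) := by
  have hmint : Integrable m Measure.haar := .of_integral_ne_zero (by rw [hm1]; exact one_ne_zero)
  have hfx : f x = ∫ g, m g • f x ∂Measure.haar := by
    rw [integral_smul_const, hm1, one_smul]
  conv in 𝓝 (f x) => rw [hfx]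
  refine tendsto_integral_filter_of_dominated_convergence (fun g ↦ m g * C) ?_ ?_
    (hmint.mul_const C) (Filter.Eventually.of_forall fun g ↦ (hlim g).const_smul (m g))
  · exact Filter.Eventually.of_forall fun r ↦
      aestronglyMeasurable_smul_chartAverage hcont ρ hρ hj hjm x hm hm0 hmint r hf
  · filter_upwards [self_mem_nhdsWithin] with r hr
    refine Filter.Eventually.of_forall fun g ↦ ?_
    rw [norm_smul, Real.norm_of_nonneg (hm0 g)]
    exact mul_le_mul_of_nonneg_left
      (norm_chartAverage_le hr (hρ _ _ (hj _)) fun z ↦ hC _) (hm0 g)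

end GroupAverages

/-! ### Iterated limits of bounded families along ultrafilters. -/

section Ultralimits

variable {ι : Type*} {𝕜 : Type*} [RCLike 𝕜]

theorem tendsto_ultrafilter_limUnder (U : Ultrafilter ι) {u : ι → 𝕜} {C : ℝ}
    (hC : ∀ i, ‖u i‖ ≤ C) : Filter.Tendsto u U (𝓝 (Filter.limUnder (U : Filter ι) u)) := by
  have hmem : ∀ i, u i ∈ Metric.closedBall (0 : 𝕜) C := fun i ↦ by simpa using hC i
  obtain ⟨a, -, ha⟩ := (isCompact_closedBall (0 : 𝕜) C).ultrafilter_le_nhds (U.map u)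
    (Filter.le_principal_iff.2 (Filter.Eventually.of_forall (f := (U : Filter ι)) hmem))
  exact tendsto_nhds_limUnder ⟨a, ha⟩

theorem norm_ultrafilter_limUnder_le (U : Ultrafilter ι) {u : ι → 𝕜} {C : ℝ}
    (hC : ∀ i, ‖u i‖ ≤ C) : ‖Filter.limUnder (U : Filter ι) u‖ ≤ C :=
  le_of_tendsto (tendsto_ultrafilter_limUnder U hC).norm (Filter.Eventually.of_forall hC)

/-- The iterated limit along two ultrafilters. -/
def iteratedLimit {κ : Type*} (U : Ultrafilter ι) (V : Ultrafilter κ) (u : ι → κ → 𝕜) : 𝕜 :=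
  Filter.limUnder (U : Filter ι) fun i ↦ Filter.limUnder (V : Filter κ) (u i)

variable {κ : Type*} {U : Ultrafilter ι} {V : Ultrafilter κ} {u u' : ι → κ → 𝕜} {C C' : ℝ}

theorem norm_iteratedLimit_le (hu : ∀ i k, ‖u i k‖ ≤ C) : ‖iteratedLimit U V u‖ ≤ C :=
  norm_ultrafilter_limUnder_le U fun i ↦ norm_ultrafilter_limUnder_le V (hu i)

theorem iteratedLimit_add (hu : ∀ i k, ‖u i k‖ ≤ C) (hu' : ∀ i k, ‖u' i k‖ ≤ C') :
    iteratedLimit U V (fun i k ↦ u i k + u' i k) =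
      iteratedLimit U V u + iteratedLimit U V u' := by
  have h : ∀ i, Filter.limUnder (V : Filter κ) (fun k ↦ u i k + u' i k) =
      Filter.limUnder (V : Filter κ) (u i) + Filter.limUnder (V : Filter κ) (u' i) := fun i ↦
    ((tendsto_ultrafilter_limUnder V (hu i)).add
      (tendsto_ultrafilter_limUnder V (hu' i))).limUnder_eq
  simp only [iteratedLimit, h]
  exact ((tendsto_ultrafilter_limUnder U fun i ↦ norm_ultrafilter_limUnder_le V (hu i)).add
    (tendsto_ultrafilter_limUnder U fun i ↦ norm_ultrafilter_limUnder_le V (hu' i))).limUnder_eq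

theorem iteratedLimit_smul (a : 𝕜) (hu : ∀ i k, ‖u i k‖ ≤ C) :
    iteratedLimit U V (fun i k ↦ a • u i k) = a • iteratedLimit U V u := by
  have h : ∀ i, Filter.limUnder (V : Filter κ) (fun k ↦ a • u i k) =
      a • Filter.limUnder (V : Filter κ) (u i) :=
    fun i ↦ ((tendsto_ultrafilter_limUnder V (hu i)).const_smul a).limUnder_eq
  simp only [iteratedLimit, h]
  exact ((tendsto_ultrafilter_limUnder U fun i ↦
    norm_ultrafilter_limUnder_le V (hu i)).const_smul a).limUnder_eq

theorem iteratedLimit_nonneg (hu : ∀ i k, ‖u i k‖ ≤ C) (h0 : ∀ i k, 0 ≤ u i k) :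
    0 ≤ iteratedLimit U V u :=
  ge_of_tendsto' (tendsto_ultrafilter_limUnder U fun i ↦ norm_ultrafilter_limUnder_le V (hu i))
    fun i ↦ ge_of_tendsto' (tendsto_ultrafilter_limUnder V (hu i)) (h0 i)

theorem iteratedLimit_eq_of_tendsto {a : 𝕜} (h : ∀ i, Filter.Tendsto (u i) V (𝓝 a)) :
    iteratedLimit U V u = a := by
  have h' : ∀ i, Filter.limUnder (V : Filter κ) (u i) = a := fun i ↦ (h i).limUnder_eq
  simp only [iteratedLimit, h']
  exact tendsto_const_nhds.limUnder_eq

theorem iteratedLimit_eq_of_norm_sub_le (hu : ∀ i k, ‖u i k‖ ≤ C) (hu' : ∀ i k, ‖u' i k‖ ≤ C')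
    {D : ι → ℝ} (hD : Filter.Tendsto D U (𝓝 0)) (h : ∀ i k, ‖u i k - u' i k‖ ≤ D i) :
    iteratedLimit U V u = iteratedLimit U V u' := by
  have h₁ : ∀ i, ‖Filter.limUnder (V : Filter κ) (u i) - Filter.limUnder (V : Filter κ) (u' i)‖ ≤ D i :=
    fun i ↦
    le_of_tendsto ((tendsto_ultrafilter_limUnder V (hu i)).sub
      (tendsto_ultrafilter_limUnder V (hu' i))).norm (Filter.Eventually.of_forall (h i))
  have h₂ := (tendsto_ultrafilter_limUnder U fun i ↦ norm_ultrafilter_limUnder_le V (hu i)).sub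
    (tendsto_ultrafilter_limUnder U fun i ↦ norm_ultrafilter_limUnder_le V (hu' i))
  exact sub_eq_zero.1 (tendsto_nhds_unique h₂ (squeeze_zero_norm h₁ hD))

end Ultralimits

/-! ### Bounded Borel representatives and maps on classes. -/

section Representatives

variable {X : Type*} [MeasurableSpace X] {μ : Measure X} {𝕜 : Type*} [RCLike 𝕜]

theorem exists_measurable_bounded_rep (φ : Lp 𝕜 ∞ μ) :
    ∃ (f : X → 𝕜) (C : ℝ), Measurable f ∧ (∀ x, ‖f x‖ ≤ C) ∧ f =ᵐ[μ] φ := by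
  have hφ : Measurable φ := (Lp.stronglyMeasurable φ).measurable
  have hfin : eLpNormEssSup φ μ ≠ ∞ := by
    have := (Lp.memLp φ).eLpNorm_ne_top
    rwa [eLpNorm_exponent_top] at this
  refine ⟨{x | ‖φ x‖ ≤ (eLpNormEssSup φ μ).toReal}.indicator φ,
    (eLpNormEssSup φ μ).toReal, hφ.indicator (measurableSet_le hφ.norm measurable_const),
    fun x ↦ ?_, ?_⟩
  · by_cases hx : x ∈ {x | ‖φ x‖ ≤ (eLpNormEssSup φ μ).toReal}
    · rw [Set.indicator_of_mem hx]
      exact hx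
    · rw [Set.indicator_of_notMem hx, norm_zero]
      exact ENNReal.toReal_nonneg
  · filter_upwards [ae_le_eLpNormEssSup (f := φ) (μ := μ)] with x hx
    refine Set.indicator_of_mem ?_ _
    change ‖φ x‖ ≤ _
    rw [← toReal_enorm]
    exact ENNReal.toReal_mono hfin hx

theorem ScriptLInf.coeFn_toClass (f : ScriptLInf 𝕜 μ) :
    (ScriptLInf.toClass f : X → 𝕜) =ᵐ[μ] (f : X → 𝕜) :=
  MemLp.coeFn_toLp _

theorem ScriptLInf.toClass_eq_iff (f : ScriptLInf 𝕜 μ) (φ : Lp 𝕜 ∞ μ) :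
    ScriptLInf.toClass f = φ ↔ (f : X → 𝕜) =ᵐ[μ] φ := by
  rw [Lp.ext_iff]
  exact ⟨fun h ↦ (ScriptLInf.coeFn_toClass f).symm.trans h,
    fun h ↦ (ScriptLInf.coeFn_toClass f).trans h⟩

/-- A map from bounded Borel functions to functions that is linear, depends on classes only, and
maps every function to a function in the same class yields a linear map on `L^∞`. -/
theorem exists_linearMap_of_borel (L : (X → 𝕜) → X → 𝕜)
    (hcongr : ∀ f f' : X → 𝕜, f =ᵐ[μ] f' → L f = L f')
    (hbdd : ∀ f : X → 𝕜, ∀ C : ℝ, (∀ x, ‖f x‖ ≤ C) → ∀ x, ‖L f x‖ ≤ C)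
    (hadd : ∀ f f' : X → 𝕜, Measurable f → Measurable f' → ∀ C C' : ℝ, (∀ x, ‖f x‖ ≤ C) →
      (∀ x, ‖f' x‖ ≤ C') → L (f + f') = L f + L f')
    (hsmul : ∀ (a : 𝕜) (f : X → 𝕜) (C : ℝ), (∀ x, ‖f x‖ ≤ C) → L (a • f) = a • L f)
    (hae : ∀ f : X → 𝕜, Measurable f → ∀ C : ℝ, (∀ x, ‖f x‖ ≤ C) → L f =ᵐ[μ] f) :
    ∃ Λ : Lp 𝕜 ∞ μ →ₗ[𝕜] ScriptLInf 𝕜 μ,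
      (∀ φ : Lp 𝕜 ∞ μ, (Λ φ : X → 𝕜) = L φ) ∧ ∀ φ, ScriptLInf.toClass (Λ φ) = φ := by
  -- The function underlying `φ` is only essentially bounded. Since `L` depends on classes alone,
  -- each property is checked on a bounded Borel representative.
  choose rep C hrepm hC hrep using fun φ : Lp 𝕜 ∞ μ ↦ exists_measurable_bounded_rep φ
  have hmem : ∀ φ : Lp 𝕜 ∞ μ, L φ ∈ ScriptLInf 𝕜 μ := fun φ ↦ by
    rw [← hcongr _ _ (hrep φ)]
    exact ⟨(hrepm φ).aestronglyMeasurable.congr (hae _ (hrepm φ) _ (hC φ)).symm, C φ,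
      hbdd _ _ (hC φ)⟩
  refine ⟨{ toFun := fun φ ↦ ⟨L φ, hmem φ⟩, map_add' := fun φ ψ ↦ ?_, map_smul' := fun a φ ↦ ?_ },
    fun φ ↦ rfl, fun φ ↦ ?_⟩
  · apply Subtype.ext
    change L _ = L _ + L _
    rw [← hcongr _ _ (hrep φ), ← hcongr _ _ (hrep ψ),
      ← hadd _ _ (hrepm φ) (hrepm ψ) _ _ (hC φ) (hC ψ)]
    exact hcongr _ _ ((Lp.coeFn_add φ ψ).trans ((hrep φ).add (hrep ψ)).symm)
  · apply Subtype.ext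
    change L _ = a • L _
    rw [← hcongr _ _ (hrep φ), ← hsmul _ _ _ (hC φ)]
    exact hcongr _ _ ((Lp.coeFn_smul a φ).trans ((hrep φ).const_smul a).symm)
  · rw [ScriptLInf.toClass_eq_iff]
    change L φ =ᵐ[μ] φ
    rw [← hcongr _ _ (hrep φ)]
    exact (hae _ (hrepm φ) _ (hC φ)).trans (hrep φ)

end Representatives

end

/-! ### Construction of the equivariant lifting. -/

theorem theoremA {𝕜 : Type*} [RCLike 𝕜]
    (G : Type u) [Group G] [TopologicalSpace G] [IsTopologicalGroup G] [LocallyCompactSpace G]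
    [T2Space G] [MeasurableSpace G] [BorelSpace G]
    (d : ℕ) (X : Type v) [TopologicalSpace X] [T2Space X] [ParacompactSpace X]
    [ChartedSpace (EuclideanSpace ℝ (Fin d)) X] [IsManifold (𝓡 d) 1 X]
    [MeasurableSpace X] [BorelSpace X]
    (γ : Bundle.ContinuousRiemannianMetric (EuclideanSpace ℝ (Fin d))
      (fun x : X ↦ TangentSpace (𝓡 d) x))
    [MulAction G X]
    (hC1 : IsC1ContinuousAction G d X)
    (hamen : IsAmenableAction.{u, v, w} G X) :
    ∃ Λ : Lp 𝕜 ∞ (riemannianVolume γ) →ₗ[𝕜] ScriptLInf 𝕜 (riemannianVolume γ),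
      IsStrongLinearLifting Λ ∧ IsEquivariant G Λ := by
  have hcont := hC1.continuous_smul
  obtain ⟨ρ, hρ⟩ := exists_chart_partitionOfUnity d X
  obtain ⟨j, hj, hjm⟩ := exists_measurable_selection ρ
  have hjs : ∀ y, y ∈ (chartAt (EuclideanSpace ℝ (Fin d)) (j y)).source := fun y ↦ hρ _ _ (hj y)
  obtain ⟨ι, _, _, _, m, hmc, hm0, hm1, hmlim⟩ := hamen
  have hmcx : ∀ i x, Continuous fun g ↦ m i (g, x) := fun i x ↦
    (hmc i).comp (Continuous.prodMk_left x)
  have hmint : ∀ i x, Integrable (fun g ↦ m i (g, x)) Measure.haar := fun i x ↦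
    .of_integral_ne_zero (by rw [hm1 i x]; exact one_ne_zero)
  let U : Ultrafilter ι := Ultrafilter.of Filter.atTop
  let V : Ultrafilter ℕ := Ultrafilter.of Filter.atTop
  let r : ℕ → ℝ := fun n ↦ 1 / ((n : ℝ) + 1)
  have hr0 : ∀ n, 0 < r n := fun n ↦ Nat.one_div_pos_of_nat
  have hr : Filter.Tendsto r V (𝓝[>] 0) :=
    (tendsto_nhdsWithin_iff.2 ⟨tendsto_one_div_add_atTop_nhds_zero_nat,
      Filter.Eventually.of_forall hr0⟩).mono_left (Ultrafilter.of_le _)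
  let u : (X → 𝕜) → X → ι → ℕ → 𝕜 := fun f x i n ↦
    groupAverage d j (fun g ↦ m i (g, x)) (r n) f x
  have hu : ∀ {f : X → 𝕜} {C : ℝ}, (∀ x, ‖f x‖ ≤ C) → ∀ x i n, ‖u f x i n‖ ≤ C :=
    fun hC x i n ↦ norm_groupAverage_le hjs (hr0 n) (fun g ↦ hm0 i _) (hm1 i x) hC
  -- The order of the limits matters: for fixed `i` the limit over radii already gives `f x` at
  -- Lebesgue points, and the limit over `i` then removes the defect of equivariance, which is
  -- bounded uniformly in `n`.
  let L : (X → 𝕜) → X → 𝕜 := fun f x ↦ iteratedLimit U V (u f x)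
  have hcongr : ∀ f f' : X → 𝕜, f =ᵐ[riemannianVolume γ] f' → L f = L f' := by
    intro f f' hff
    have hnull : IsLocNull d {x | f x ≠ f' x} :=
      (riemannianVolume_eq_zero_iff γ).1 (ae_iff.1 hff)
    have huu : u f = u f' := by
      funext x i n
      exact groupAverage_congr hC1 hnull
    simp only [L, huu]
  have hlim : ∀ {f : X → 𝕜} {C : ℝ} {x : X}, Measurable f → (∀ x, ‖f x‖ ≤ C) →
      (∀ g : G, Filter.Tendsto
        (fun r ↦ chartAverage d j r (fun z ↦ f (g • z)) (g⁻¹ • x)) (𝓝[>] 0) (𝓝 (f x))) →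
      L f x = f x := fun {f C x} hf hC h ↦
    iteratedLimit_eq_of_tendsto fun i ↦ (tendsto_groupAverage hcont hρ hj hjm (hmcx i x)
      (fun g ↦ hm0 i _) (hm1 i x) hf hC h).comp hr
  have hadd : ∀ {f f' : X → 𝕜} {C C' : ℝ}, Measurable f → Measurable f' → (∀ x, ‖f x‖ ≤ C) →
      (∀ x, ‖f' x‖ ≤ C') → ∀ x, u (f + f') x = fun i n ↦ u f x i n + u f' x i n :=
    fun hf hf' hC hC' x ↦ funext fun i ↦ funext fun n ↦
      groupAverage_add hcont hρ hj hjm (hmcx i x) (fun g ↦ hm0 i _) (hmint i x) (hr0 n) hf hC hf' hC'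
  have hsmul : ∀ (a : 𝕜) (f : X → 𝕜) (x : X), u (a • f) x = fun i n ↦ a • u f x i n :=
    fun a f x ↦ funext fun i ↦ funext fun n ↦ groupAverage_smul a
  obtain ⟨Λ, hΛ, hΛclass⟩ := exists_linearMap_of_borel (μ := riemannianVolume γ) L hcongr
    (fun f C hC x ↦ norm_iteratedLimit_le (hu hC x))
    (fun f f' hf hf' C C' hC hC' ↦ funext fun x ↦
      (congrArg (iteratedLimit U V) (hadd hf hf' hC hC' x)).trans
        (iteratedLimit_add (hu hC x) (hu hC' x)))
    (fun a f C hC ↦ funext fun x ↦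
      (congrArg (iteratedLimit U V) (hsmul a f x)).trans (iteratedLimit_smul a (hu hC x)))
    (fun f hf C hC ↦ by
      refine (ae_iff.2 ((riemannianVolume_eq_zero_iff γ).2
        ((isLocNull_not_isChartLebesguePoint (d := d) hf hC).mono fun x hx hleb ↦ hx ?_)))
      exact hlim hf hC (tendsto_chartAverage_smul hC1 hjs hf hC hleb))
  have hΛ' : ∀ f : ScriptLInf 𝕜 (riemannianVolume γ),
      (Λ (ScriptLInf.toClass f) : X → 𝕜) = L f := fun f ↦
    (hΛ _).trans (hcongr _ _ (ScriptLInf.coeFn_toClass f))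
  have hcontΛ : ∀ f : ScriptLInf 𝕜 (riemannianVolume γ), Continuous (f : X → 𝕜) →
      Λ (ScriptLInf.toClass f) = f := fun f hf ↦ by
    obtain ⟨-, C, hC⟩ := f.2
    refine Subtype.ext ((hΛ' f).trans (funext fun x ↦ ?_))
    exact hlim hf.measurable hC (tendsto_chartAverage_smul_of_continuous hC1 hjs hf hC x)
  refine ⟨Λ, ⟨⟨fun φ hφ x ↦ ?_, hΛclass, fun f hf ↦ hcontΛ f ?_⟩, hcontΛ⟩, fun s f ↦ ?_⟩
  · obtain ⟨f, C, -, hC, hfφ⟩ := exists_measurable_bounded_rep φ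
    -- Positivity of the averages needs a representative that is non-negative everywhere; cutting
    -- off changes `f` on a null set only.
    have hpos : {x | 0 ≤ f x}.indicator f =ᵐ[riemannianVolume γ] φ := by
      filter_upwards [hfφ, hφ] with x hx hx'
      rw [Set.indicator_of_mem (show x ∈ {x | 0 ≤ f x} by
        change 0 ≤ f x
        rwa [hx]), hx]
    rw [hΛ, ← hcongr _ _ hpos]
    refine iteratedLimit_nonneg
      (hu (fun x ↦ (norm_indicator_le_norm_self _ _).trans (hC x)) x) fun i n ↦ ?_
    exact groupAverage_nonneg (fun g ↦ hm0 i _) fun x ↦ Set.indicator_nonneg (fun y hy ↦ hy) x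
  · rw [hf]
    exact continuous_one
  -- As `f` is measurable only for the completed measure, its translate is again measurable because
  -- the action preserves null sets.
  · have hs : Measure.QuasiMeasurePreserving (fun x : X ↦ s⁻¹ • x) (riemannianVolume γ)
        (riemannianVolume γ) := by
      have hmeas : Measurable fun x : X ↦ s⁻¹ • x := (hC1.continuous_const_smul s⁻¹).measurable
      refine ⟨hmeas, Measure.AbsolutelyContinuous.mk fun A hA h0 ↦ ?_⟩
      rw [Measure.map_apply hmeas hA]
      exact (riemannianVolume_eq_zero_iff γ).2
        (((riemannianVolume_eq_zero_iff γ).1 h0).preimage_smul hC1 s⁻¹)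
    obtain ⟨hfm, C, hC⟩ := f.2
    refine ⟨⟨hfm.comp_quasiMeasurePreserving hs, C, fun x ↦ hC _⟩, fun x ↦ ?_⟩
    obtain ⟨f₀, C₀, hf₀, hC₀, hff₀⟩ := exists_measurable_bounded_rep (ScriptLInf.toClass f)
    replace hff₀ := hff₀.trans (ScriptLInf.coeFn_toClass f)
    rw [hΛ', hΛ', ← hcongr _ _ hff₀]
    have h₁ : (fun x ↦ f₀ (s⁻¹ • x)) =ᵐ[riemannianVolume γ]
        fun x ↦ (f : X → 𝕜) (s⁻¹ • x) := hs.ae_eq_comp hff₀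
    change L (fun x ↦ (f : X → 𝕜) (s⁻¹ • x)) x = _
    rw [← hcongr _ _ h₁]
    -- Amenability at the point `(s, s⁻¹ • x)`, where `s • s⁻¹ • x = x`, compares the weight
    -- produced by translating `f` with the weight at `s⁻¹ • x`.
    have hD : Filter.Tendsto (fun i ↦ (∫ g, |m i (s * g, s • s⁻¹ • x) - m i (g, s⁻¹ • x)|
        ∂Measure.haar) * C₀) U (𝓝 0) := by
      have h := (hmlim {(s, s⁻¹ • x)} isCompact_singleton).tendsto_at (Set.mem_singleton _)
      simpa using (h.mono_left (Ultrafilter.of_le _)).mul_const C₀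
    refine iteratedLimit_eq_of_norm_sub_le (hu (fun x ↦ hC₀ _) x) (hu hC₀ (s⁻¹ • x)) hD
      fun i n ↦ ?_
    simp only [u, groupAverage_translate, smul_inv_smul]
    exact norm_groupAverage_sub_le hcont hρ hj hjm
      ((hmcx i x).comp (continuous_const_mul s)) (fun g ↦ hm0 i _) ((hmint i x).comp_mul_left s)
      (hmcx i _) (fun g ↦ hm0 i _) (hmint i _) (hr0 n) hf₀ hC₀
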